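/- An *implicative algebra* $\mathbb A=(A,\le,\to,\Sigma)$ is a complete lattice $(A,\le)$ with a map $\to\,:A\times A\to A$, antitone in the first and monotone in the second argument, with $a\to\bigwedge_{i\in I}b_i=\bigwedge_{i\in I}(a\to b_i)$ for all families, and an upward closed $\Sigma\subseteq A$ that contains $b$ whenever it contains $a\to b$ and $a$, and that contains $\bigwedge_{a,b}(a\to(b\to a))$ and $\bigwedge_{a,b,c}((a\to(b\to c))\to((a\to b)\to(a\to c)))$. It is *classical* if $\bigwedge_{a,b}(((a\to b)\to a)\to a)\in\Sigma$. Put $$a\times b=\bigwedge_{x\in A}\big((a\to(b\to x))\to x\big),\qquad a+b=\bigwedge_{x\in A}\big((a\to x)\to((b\to x)\to x)\big),$$ $$\mathop{\forall}_{i\in I}a_i=\bigwedge_{i\in I}a_i,\qquad \mathop{\exists}_{i\in I}a_i=\bigwedge_{x\in A}\Big(\bigwedge_{i\in I}(a_i\to x)\to x\Big).$$ Let $\kappa$ be a strongly inaccessible cardinal and $\mathbb A$ an implicative algebra with $|A|<\kappa$. Let $W_0=\emptyset$, let $W_{\beta+1}$ be the set of partial functions from $W_\beta$ to $A$, let $W_\alpha=\bigcup_{\beta<\alpha}W_\beta$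 for limit $\alpha$, and let $\mathbf W=W_\kappa$. Writing $\partial_0(\alpha)$ for the domain of the partial function $\alpha$, define by recursion on rank $\in_{\mathbf W},=_{\mathbf W}:\mathbf W\times\mathbf W\to A$ by $$\alpha\in_{\mathbf W}\beta=\mathop{\exists}_{t\in\partial_0(\beta)}\big(\beta(t)\times(t=_{\mathbf W}\alpha)\big),\qquad \alpha=_{\mathbf W}\beta=(\alpha\subseteq_{\mathbf W}\beta)\times(\beta\subseteq_{\mathbf W}\alpha),$$ where $\alpha\subseteq_{\mathbf W}\beta=\mathop{\forall}_{t\in\partial_0(\alpha)}(\alpha(t)\to t\in_{\mathbf W}\beta)$. To each formula $\varphi$ of the language $\{\in,=\}$ (built from $\bot,\wedge,\vee,\to,\exists,\forall$) in a context of $n$ variables assign $\|\varphi\|:\mathbf W^n\to A$, interpreting $\in,=,\bot,\wedge,\vee,\to$ by $\in_{\mathbf W},=_{\mathbf W},\bot,\times,+,\to$ and the quantifiers by $\mathop{\exists}_{\beta\in\mathbf W}$ and $\mathop{\forall}_{\beta\in\mathbf W}$. Write $\mathbf W\models\varphi$ if $\bigwedge_{\underline\alpha\in\mathbf W^n}\|\varphi\|(\underline\alpha)\in\Sigma$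 (for closed $\varphi$: $\|\varphi\|\in\Sigma$). The theories $\mathbf{IZF}$ and $\mathbf{ZF}$ have the following axioms, where $\forall x\in y\,\varphi$ is $\forall x(x\in y\to\varphi)$, $\exists x\in y\,\varphi$ is $\exists x(x\in y\wedge\varphi)$, and $x\subseteq y$ is $\forall z\in x\,(z\in y)$: * Extensionality: $\forall x\forall y(x\subseteq y\wedge y\subseteq x\to x=y)$. * Pairing: $\forall x\forall y\exists z(x\in z\wedge y\in z)$. * Union: $\forall x\exists u\forall y\in x\,\forall z\in y\,(z\in u)$. * Powerset: $\forall x\exists z\forall y(y\subseteq x\to y\in z)$. * Infinity: $\exists u\big(\exists x\in u\,\forall y\in x\,\bot\;\wedge\;\forall x\in u\,\exists y\in u\,(x\subseteq y\wedge x\in y\wedge\forall z\in y\,(z\in x\vee z=x))\big)$. * Separation, for each $\varphi[\underline w,x,z]$: $\forall\underline w\forall x\exists y\big(\forall z\in y\,(z\in x\wedge\varphi)\wedge\forall z\in x\,(\varphi\to z\in y)\big)$. * Collection, for each $\varphi[\underline w,x,y,z]$: $\forall\underline w\forall y\big(\forall x\in y\,\exists z\,\varphi\to\exists u\,\forall x\in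 y\,\exists z\in u\,\varphi\big)$. * $\in$-induction, for each $\varphi[\underline w,x]$: $\forall\underline w\big(\forall x(\forall y\in x\,\varphi[y/x]\to\varphi)\to\forall x\,\varphi\big)$. $\mathbf{IZF}$ is based on intuitionistic and $\mathbf{ZF}$ on classical first-order logic with equality. Then: 1. $\|\psi\|\in\Sigma$ for every one of these axioms $\psi$ (hence every axiom of $\mathbf{IZF}$ is valid in $\mathbf W$, and so is every axiom of $\mathbf{ZF}$, in particular when $\mathbb A$ is classical); 2. for every formula $\varphi$ in context, if $\mathbf{IZF}\vdash\varphi$, then $\mathbf W\models\varphi$; 3. if $\mathbb A$ is classical, then for every formula $\varphi$ in context, if $\mathbf{ZF}\vdash\varphi$, then $\mathbf W\models\varphi$. -/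

import Mathlib

universe u

/-! ### Implicative algebras -/

/-- An implicative algebra: a complete lattice with an implication and a separator. -/
class ImplicativeAlgebra (A : Type u) extends CompleteLattice A where
  /-- the implication `a → b` -/
  imp : A → A → A
  /-- the separator `Σ` -/
  sep : Set A
  imp_mono : ∀ {a a' b b' : A}, a' ≤ a → b ≤ b' → imp a b ≤ imp a' b'
  imp_sInf : ∀ (a : A) (B : Set A), imp a (sInf B) = ⨅ b ∈ B, imp a b
  sep_upward : ∀ {a b : A}, a ≤ b → a ∈ sep → b ∈ sep
  sep_mp : ∀ {a b : A}, imp a b ∈ sep → a ∈ sep → b ∈ sep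
  sep_K : (⨅ a : A, ⨅ b : A, imp a (imp b a)) ∈ sep
  sep_S : (⨅ a : A, ⨅ b : A, ⨅ c : A,
    imp (imp a (imp b c)) (imp (imp a b) (imp a c))) ∈ sep

namespace ImplicativeAlgebra

section Connectives

variable {A : Type u} [ImplicativeAlgebra A]

/-- Implicative conjunction `a × b`. -/
def conj (a b : A) : A := ⨅ x : A, imp (imp a (imp b x)) x

/-- Implicative disjunction `a + b`. -/
def disj (a b : A) : A := ⨅ x : A, imp (imp a x) (imp (imp b x) x)

/-- Implicative existential quantifier `∃ i, a i` (the universal one is the meet `⨅ i, a i`). -/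
def exi {ι : Type*} (a : ι → A) : A := ⨅ x : A, imp (⨅ i, imp (a i) x) x

end Connectives

/-- An implicative algebra is classical if its separator contains the interpretation of
Peirce's law. -/
def IsClassical (A : Type u) [ImplicativeAlgebra A] : Prop :=
  (⨅ a : A, ⨅ b : A, imp (imp (imp a b) a) a) ∈ (sep : Set A)

end ImplicativeAlgebra

/-! ### First-order formulas of set theory and their provability -/

/-- `SetFormula n` is the type of formulas of the language of set theory in a context of `n`
variables, with all connectives primitive.  Variables are de Bruijn indices: in the body of a
quantifier, `0` is the bound variable and `i.succ` is the old variable `i`. -/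
inductive SetFormula : ℕ → Type
  | mem {n : ℕ} (i j : Fin n) : SetFormula n
  | eq {n : ℕ} (i j : Fin n) : SetFormula n
  | bot {n : ℕ} : SetFormula n
  | and {n : ℕ} (φ ψ : SetFormula n) : SetFormula n
  | or {n : ℕ} (φ ψ : SetFormula n) : SetFormula n
  | imp {n : ℕ} (φ ψ : SetFormula n) : SetFormula n
  | ex {n : ℕ} (φ : SetFormula (n + 1)) : SetFormula n
  | all {n : ℕ} (φ : SetFormula (n + 1)) : SetFormula n

namespace SetFormula

/-- Capture-avoiding simultaneous substitution of variables for variables (the variables are the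
only terms of the language). -/
def subst : {m n : ℕ} → (Fin m → Fin n) → SetFormula m → SetFormula n
  | _, _, f, mem i j => mem (f i) (f j)
  | _, _, f, eq i j => eq (f i) (f j)
  | _, _, _, bot => bot
  | _, _, f, and φ ψ => and (subst f φ) (subst f ψ)
  | _, _, f, or φ ψ => or (subst f φ) (subst f ψ)
  | _, _, f, imp φ ψ => imp (subst f φ) (subst f ψ)
  | _, n, f, ex φ => ex (subst (Fin.cons 0 fun i => (f i).succ : Fin _ → Fin (n + 1)) φ)
  | _, n, f, all φ => all (subst (Fin.cons 0 fun i => (f i).succ : Fin _ → Fin (n + 1)) φ)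

/-- The same formula in the context extended by one fresh variable. -/
def weaken {n : ℕ} (φ : SetFormula n) : SetFormula (n + 1) := φ.subst Fin.succ

/-- Substitution of the variable `i` for the variable `0` in the body of a quantifier. -/
def inst {n : ℕ} (φ : SetFormula (n + 1)) (i : Fin n) : SetFormula n :=
  φ.subst (Fin.cons i id : Fin (n + 1) → Fin n)

/-- `∀ z ∈ i, φ` -/
def ballIn {n : ℕ} (i : Fin n) (φ : SetFormula (n + 1)) : SetFormula n :=
  all (imp (mem 0 i.succ) φ)

/-- `∃ z ∈ i, φ` -/
def bexIn {n : ℕ} (i : Fin n) (φ : SetFormula (n + 1)) : SetFormula n :=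
  ex (and (mem 0 i.succ) φ)

/-- `i ⊆ j`, that is `∀ z ∈ i, z ∈ j` -/
def sub {n : ℕ} (i j : Fin n) : SetFormula n := ballIn i (mem 0 j.succ)

/-- Universal closure. -/
def closure : {n : ℕ} → SetFormula n → SetFormula 0
  | 0, φ => φ
  | _ + 1, φ => closure (all φ)

/-- Natural deduction for first-order logic with equality, over a set `T` of closed axioms.
`Derives c T Γ φ` is derivability of `φ` from the hypotheses `Γ`, everything in a context of `n`
free variables; the logic is intuitionistic if the proposition `c` is false, and classical
(the rule `raa` is available) if `c` is true. -/
inductive Derives (c : Prop) (T : Set (SetFormula 0)) :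
    {n : ℕ} → List (SetFormula n) → SetFormula n → Prop
  | ax {n : ℕ} {Γ : List (SetFormula n)} {φ : SetFormula 0} (h : φ ∈ T) :
      Derives c T Γ (φ.subst Fin.elim0)
  | hyp {n : ℕ} {Γ : List (SetFormula n)} {φ : SetFormula n} (h : φ ∈ Γ) : Derives c T Γ φ
  | botE {n : ℕ} {Γ : List (SetFormula n)} {φ : SetFormula n} :
      Derives c T Γ bot → Derives c T Γ φ
  | andI {n : ℕ} {Γ : List (SetFormula n)} {φ ψ : SetFormula n} :
      Derives c T Γ φ → Derives c T Γ ψ → Derives c T Γ (and φ ψ)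
  | andE₁ {n : ℕ} {Γ : List (SetFormula n)} {φ ψ : SetFormula n} :
      Derives c T Γ (and φ ψ) → Derives c T Γ φ
  | andE₂ {n : ℕ} {Γ : List (SetFormula n)} {φ ψ : SetFormula n} :
      Derives c T Γ (and φ ψ) → Derives c T Γ ψ
  | orI₁ {n : ℕ} {Γ : List (SetFormula n)} {φ ψ : SetFormula n} :
      Derives c T Γ φ → Derives c T Γ (or φ ψ)
  | orI₂ {n : ℕ} {Γ : List (SetFormula n)} {φ ψ : SetFormula n} :
      Derives c T Γ ψ → Derives c T Γ (or φ ψ)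
  | orE {n : ℕ} {Γ : List (SetFormula n)} {φ ψ χ : SetFormula n} :
      Derives c T Γ (or φ ψ) → Derives c T (φ :: Γ) χ → Derives c T (ψ :: Γ) χ →
      Derives c T Γ χ
  | impI {n : ℕ} {Γ : List (SetFormula n)} {φ ψ : SetFormula n} :
      Derives c T (φ :: Γ) ψ → Derives c T Γ (imp φ ψ)
  | impE {n : ℕ} {Γ : List (SetFormula n)} {φ ψ : SetFormula n} :
      Derives c T Γ (imp φ ψ) → Derives c T Γ φ → Derives c T Γ ψ
  | allI {n : ℕ} {Γ : List (SetFormula n)} {φ : SetFormula (n + 1)} :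
      Derives c T (Γ.map weaken) φ → Derives c T Γ (all φ)
  | allE {n : ℕ} {Γ : List (SetFormula n)} {φ : SetFormula (n + 1)} (i : Fin n) :
      Derives c T Γ (all φ) → Derives c T Γ (φ.inst i)
  | exI {n : ℕ} {Γ : List (SetFormula n)} {φ : SetFormula (n + 1)} (i : Fin n) :
      Derives c T Γ (φ.inst i) → Derives c T Γ (ex φ)
  | exE {n : ℕ} {Γ : List (SetFormula n)} {φ : SetFormula (n + 1)} {ψ : SetFormula n} :
      Derives c T Γ (ex φ) → Derives c T (φ :: Γ.map weaken) ψ.weaken → Derives c T Γ ψ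
  | eqRefl {n : ℕ} {Γ : List (SetFormula n)} (i : Fin n) : Derives c T Γ (eq i i)
  | eqSubst {n : ℕ} {Γ : List (SetFormula n)} (φ : SetFormula (n + 1)) {i j : Fin n} :
      Derives c T Γ (eq i j) → Derives c T Γ (φ.inst i) → Derives c T Γ (φ.inst j)
  | raa {n : ℕ} {Γ : List (SetFormula n)} {φ : SetFormula n} (h : c) :
      Derives c T (imp φ bot :: Γ) bot → Derives c T Γ φ

/-! ### The axioms of (I)ZF -/

/-- `∀ x ∀ y (x ⊆ y ∧ y ⊆ x → x = y)` -/
def axExt : SetFormula 0 :=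
  all (all (imp (and (sub 1 0) (sub 0 1)) (eq 1 0)))

/-- `∀ x ∀ y ∃ z (x ∈ z ∧ y ∈ z)` -/
def axPair : SetFormula 0 :=
  all (all (ex (and (mem 2 0) (mem 1 0))))

/-- `∀ x ∃ u ∀ y ∈ x ∀ z ∈ y (z ∈ u)` -/
def axUnion : SetFormula 0 :=
  all (ex (ballIn 1 (ballIn 0 (mem 0 2))))

/-- `∀ x ∃ z ∀ y (y ⊆ x → y ∈ z)` -/
def axPow : SetFormula 0 :=
  all (ex (all (imp (sub 0 2) (mem 0 1))))

/-- `∃ x ∈ u ∀ y ∈ x ⊥`, where `u` is the variable `0` -/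
def inf₁ : SetFormula 1 := bexIn 0 (ballIn 0 bot)

/-- `∀ x ∈ u ∃ y ∈ u (x ⊆ y ∧ x ∈ y ∧ ∀ z ∈ y (z ∈ x ∨ z = x))`, where `u` is the variable `0` -/
def inf₂ : SetFormula 1 :=
  ballIn 0 (bexIn 1 (and (sub 1 0) (and (mem 1 0) (ballIn 0 (or (mem 0 2) (eq 0 2))))))

/-- `∃ u (Inf₁(u) ∧ Inf₂(u))` -/
def axInf : SetFormula 0 := ex (and inf₁ inf₂)

/-- `∀ w₁ … ∀ wₙ ∀ x ∃ y (∀ z ∈ y (z ∈ x ∧ φ) ∧ ∀ z ∈ x (φ → z ∈ y))`, for `φ` in the context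
`w₁, …, wₙ, x, z`: in `φ` the variable `0` is `z` and `1` is `x`. Under the quantifiers
`∀ x ∃ y ∀ z`, the variable `0` is `z`, `1` is `y` and `2` is `x`. -/
def axSep {n : ℕ} (φ : SetFormula (n + 2)) : SetFormula 0 :=
  let φ' : SetFormula (n + 3) :=
    φ.subst (Fin.cons 0 fun i => i.succ.succ : Fin (n + 2) → Fin (n + 3))
  closure (n := n) (all (ex (and
    (ballIn 0 (and (mem 0 2) φ'))
    (ballIn 1 (imp φ' (mem 0 1))))))

/-- `∀ w₁ … ∀ wₙ ∀ y (∀ x ∈ y ∃ z φ → ∃ u ∀ x ∈ y ∃ z ∈ u φ)`, for `φ` in the context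
`w₁, …, wₙ, x, y, z`: in `φ` the variable `0` is `z`, `1` is `x` and `2` is `y`. Under the
quantifiers `∀ y ∃ u ∀ x ∃ z`, the variable `0` is `z`, `1` is `x`, `2` is `u` and `3` is `y`. -/
def axCol {n : ℕ} (φ : SetFormula (n + 3)) : SetFormula 0 :=
  let φ' : SetFormula (n + 4) :=
    φ.subst (Fin.cons 0 (Fin.cons 1 fun i => i.succ.succ.succ) : Fin (n + 3) → Fin (n + 4))
  closure (n := n) (all (imp
    (ballIn 0 (ex φ))
    (ex (ballIn 1 (bexIn 1 φ')))))

/-- `∀ w₁ … ∀ wₙ (∀ x (∀ y ∈ x φ[y/x] → φ) → ∀ x φ)`, for `φ` in the context `w₁, …, wₙ, x`: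
in `φ` the variable `0` is `x`. Under the quantifiers `∀ x ∀ y`, the variable `0` is `y` and
`1` is `x`. -/
def axInd {n : ℕ} (φ : SetFormula (n + 1)) : SetFormula 0 :=
  let φ' : SetFormula (n + 2) :=
    φ.subst (Fin.cons 0 fun i => i.succ.succ : Fin (n + 1) → Fin (n + 2))
  closure (n := n) (imp (all (imp (ballIn 0 φ') φ)) (all φ))

/-- The set of axioms shared by `IZF` and `ZF`. -/
inductive ZFAxiom : SetFormula 0 → Prop
  | ext : ZFAxiom axExt
  | pair : ZFAxiom axPair
  | union : ZFAxiom axUnion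
  | pow : ZFAxiom axPow
  | inf : ZFAxiom axInf
  | sep {n : ℕ} (φ : SetFormula (n + 2)) : ZFAxiom (axSep φ)
  | col {n : ℕ} (φ : SetFormula (n + 3)) : ZFAxiom (axCol φ)
  | ind {n : ℕ} (φ : SetFormula (n + 1)) : ZFAxiom (axInd φ)

/-- `IZF ⊢ φ`: derivability from the axioms in intuitionistic first-order logic with equality. -/
def IZFProves {n : ℕ} (φ : SetFormula n) : Prop := Derives False {ψ | ZFAxiom ψ} [] φ

/-- `ZF ⊢ φ`: derivability from the axioms in classical first-order logic with equality. -/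
def ZFProves {n : ℕ} (φ : SetFormula n) : Prop := Derives True {ψ | ZFAxiom ψ} [] φ

end SetFormula

/-! ### The model -/

namespace ImpModel

open ImplicativeAlgebra

/-- The set `Part(X, A)` of partial functions from `X` to `A`, as graphs.  The type `A` is
identified with the set of the `e a`, `a : A`. -/
noncomputable def partialFunctions {A : Type u} (e : A ↪ ZFSet.{u}) (X : ZFSet.{u}) :
    ZFSet.{u} :=
  ZFSet.sep
    (fun f => ∀ x y y' : ZFSet.{u}, ZFSet.pair x y ∈ f → ZFSet.pair x y' ∈ f → y = y')
    (ZFSet.powerset (ZFSet.prod X (ZFSet.range e)))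

/-- The hierarchy `W₀ = ∅`, `W_{β+1} = Part(W_β, A)`, `W_α = ⋃_{β < α} W_β` for limit `α`. -/
noncomputable def hierarchy {A : Type u} (e : A ↪ ZFSet.{u}) (α : Ordinal.{u}) : ZFSet.{u} :=
  Ordinal.limitRecOn α
    ∅
    (fun _ W => partialFunctions e W)
    (fun α _ W => ZFSet.iUnion fun β : Set.Iio α => W β.1 β.2)

section HierarchyFacts

variable {A : Type u} {e : A ↪ ZFSet.{u}}

theorem mem_partialFunctions {X f : ZFSet.{u}} :
    f ∈ partialFunctions e X ↔
      (∀ p ∈ f, ∃ x ∈ X, ∃ a : A, p = ZFSet.pair x (e a)) ∧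
      ∀ x y y' : ZFSet.{u}, ZFSet.pair x y ∈ f → ZFSet.pair x y' ∈ f → y = y' := by
  simp only [partialFunctions, ZFSet.mem_sep, ZFSet.mem_powerset, ZFSet.subset_def,
    ZFSet.mem_prod, ZFSet.mem_range]
  refine and_congr_left fun _ => forall₂_congr fun p _ => ?_
  constructor
  · rintro ⟨x, hx, _, ⟨a, rfl⟩, h⟩
    exact ⟨x, hx, a, h⟩
  · rintro ⟨x, hx, a, h⟩
    exact ⟨x, hx, _, ⟨a, rfl⟩, h⟩

theorem partialFunctions_mono {X Y : ZFSet.{u}} (h : X ⊆ Y) :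
    partialFunctions e X ⊆ partialFunctions e Y := by
  intro f hf
  rw [mem_partialFunctions] at hf ⊢
  refine ⟨fun p hp => ?_, hf.2⟩
  obtain ⟨x, hx, a, rfl⟩ := hf.1 p hp
  exact ⟨x, h hx, a, rfl⟩

theorem hierarchy_zero : hierarchy e 0 = ∅ := by
  simp [hierarchy]

theorem hierarchy_succ (α : Ordinal.{u}) :
    hierarchy e (α + 1) = partialFunctions e (hierarchy e α) := by
  simp [hierarchy]

theorem mem_hierarchy_limit {α : Ordinal.{u}} (hα : Order.IsSuccLimit α) {x : ZFSet.{u}} :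
    x ∈ hierarchy e α ↔ ∃ β < α, x ∈ hierarchy e β := by
  rw [hierarchy, Ordinal.limitRecOn_limit _ _ _ _ hα, ZFSet.mem_iUnion]
  exact ⟨fun ⟨β, h⟩ => ⟨β.1, β.2, h⟩, fun ⟨β, hβ, h⟩ => ⟨⟨β, hβ⟩, h⟩⟩

theorem hierarchy_subset_succ (α : Ordinal.{u}) : hierarchy e α ⊆ hierarchy e (α + 1) := by
  induction α using Ordinal.limitRecOn with
  | zero => simp [hierarchy_zero]
  | add_one α ih =>
    rw [hierarchy_succ (α + 1)]
    nth_rewrite 1 [hierarchy_succ α]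
    exact partialFunctions_mono ih
  | limit α hα ih =>
    intro x hx
    obtain ⟨β, hβ, hx⟩ := (mem_hierarchy_limit hα).1 hx
    have h1 := ih β hβ hx
    rw [hierarchy_succ] at h1 ⊢
    refine partialFunctions_mono ?_ h1
    intro y hy
    exact (mem_hierarchy_limit hα).2 ⟨β, hβ, hy⟩

/-- The arguments of a partial function in `W_α` are in `W_α`. -/
theorem mem_hierarchy_of_pair {α : Ordinal.{u}} {f x y : ZFSet.{u}}
    (hf : f ∈ hierarchy e α) (h : ZFSet.pair x y ∈ f) : x ∈ hierarchy e α := by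
  have key : f ∈ hierarchy e (α + 1) := hierarchy_subset_succ α hf
  rw [hierarchy_succ, mem_partialFunctions] at key
  obtain ⟨x', hx', a, hp⟩ := key.1 _ h
  rw [ZFSet.pair_inj] at hp
  exact hp.1 ▸ hx'

theorem exists_of_pair {α : Ordinal.{u}} {f x y : ZFSet.{u}}
    (hf : f ∈ hierarchy e α) (h : ZFSet.pair x y ∈ f) : ∃ a : A, y = e a := by
  have key : f ∈ hierarchy e (α + 1) := hierarchy_subset_succ α hf
  rw [hierarchy_succ, mem_partialFunctions] at key
  obtain ⟨x', hx', a, hp⟩ := key.1 _ h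
  rw [ZFSet.pair_inj] at hp
  exact ⟨a, hp.2⟩

end HierarchyFacts

/-- The model `W = W_κ`. -/
def W {A : Type u} (e : A ↪ ZFSet.{u}) (κ : Cardinal.{u}) : Type (u + 1) :=
  {x : ZFSet.{u} // x ∈ hierarchy e κ.ord}

section Model

variable {A : Type u} {e : A ↪ ZFSet.{u}} {κ : Cardinal.{u}}

/-- The domain `∂₀(α)` of the partial function `α`. -/
def dom (α : W e κ) : Set (W e κ) := {t | ∃ a : A, ZFSet.pair t.1 (e a) ∈ α.1}

/-- The value `α(t)` of the partial function `α` at a point `t` of its domain. -/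
noncomputable def val (α : W e κ) (t : dom α) : A := t.2.choose

theorem pair_val_mem (α : W e κ) (t : dom α) : ZFSet.pair t.1.1 (e (val α t)) ∈ α.1 :=
  t.2.choose_spec

theorem rank_lt_of_mem_dom {α t : W e κ} (h : t ∈ dom α) : t.1.rank < α.1.rank := by
  obtain ⟨a, ha⟩ := h
  have h1 : t.1 ∈ ({t.1} : ZFSet.{u}) := by simp
  have h2 : ({t.1} : ZFSet.{u}) ∈ ZFSet.pair t.1 (e a) := by simp [ZFSet.pair]
  exact (ZFSet.rank_lt_of_mem h1).trans
    ((ZFSet.rank_lt_of_mem h2).trans (ZFSet.rank_lt_of_mem ha))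

/-- Well-foundedness of the domain relation on `W`. -/
theorem wellFounded_dom : WellFounded fun t α : W e κ => t ∈ dom α :=
  Subrelation.wf (fun {_ _} h => rank_lt_of_mem_dom h)
    (InvImage.wf (fun α : W e κ => α.1.rank) wellFounded_lt)

variable [ImplicativeAlgebra A]

mutual

/-- `α ∈_W β := ∃ t ∈ ∂₀(β), β(t) × (t =_W α)` -/
noncomputable def memW (α β : W e κ) : A :=
  exi fun t : dom β => conj (val β t) (eqW t.1 α)
termination_by wellFounded_dom.sym2_gameAdd.wrap s(α, β)
decreasing_by
  exact Sym2.GameAdd.fst_snd t.2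

/-- `α =_W β := (α ⊆_W β) × (β ⊆_W α)`, where `α ⊆_W β := ∀ t ∈ ∂₀(α), α(t) → t ∈_W β` -/
noncomputable def eqW (α β : W e κ) : A :=
  conj (⨅ t : dom α, imp (val α t) (memW t.1 β)) (⨅ t : dom β, imp (val β t) (memW t.1 α))
termination_by wellFounded_dom.sym2_gameAdd.wrap s(α, β)
decreasing_by
  · exact Sym2.GameAdd.fst t.2
  · exact Sym2.GameAdd.fst_snd t.2

end

/-- The interpretation `‖φ‖ : Wⁿ → A` of a formula in a context of `n` variables. -/
noncomputable def interp : {n : ℕ} → SetFormula n → (Fin n → W e κ) → A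
  | _, .mem i j, v => memW (v i) (v j)
  | _, .eq i j, v => eqW (v i) (v j)
  | _, .bot, _ => ⊥
  | _, .and φ ψ, v => conj (interp φ v) (interp ψ v)
  | _, .or φ ψ, v => disj (interp φ v) (interp ψ v)
  | _, .imp φ ψ, v => imp (interp φ v) (interp ψ v)
  | n, .ex φ, v => exi fun β : W e κ => interp φ (Fin.cons β v : Fin (n + 1) → W e κ)
  | n, .all φ, v => ⨅ β : W e κ, interp φ (Fin.cons β v : Fin (n + 1) → W e κ)

variable (e κ) in
/-- `W ⊨ φ`: the meet of the values of `φ` is in the separator.  For a closed formula this meet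
is over a single (empty) valuation, so that it is the value of `φ` itself. -/
def Models {n : ℕ} (φ : SetFormula n) : Prop :=
  (⨅ v : Fin n → W e κ, interp φ v) ∈ (sep : Set A)

theorem models_closed_iff (φ : SetFormula 0) :
    Models e κ φ ↔ interp φ (Fin.elim0 : Fin 0 → W e κ) ∈ (sep : Set A) := by
  rw [Models, iInf_unique]
  rw [Subsingleton.elim (default : Fin 0 → W e κ) Fin.elim0]

end Model

end ImpModel

/-!
The model is a realizability model, and every valid statement has a realizer that is an untyped
λ-term.  In an implicative algebra, application `a · b` is the least `c` with `a ≤ b → c`, and the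
abstraction of `f` is `⋀ a, (a → f a)`.  Because the separator contains the combinators `K` and `S`,
the value of each closed λ-term is in the separator (`Term.eval_nil_mem_sep`).  A term realizes
`a` if its value is at most `a`; realizers obey the rules of natural deduction (`Realizes`), and
a realizer of all instances of a statement realizes their meet.  So to prove a statement valid
one exhibits a single term that realizes it for all values of its parameters.  This is why most
lemmas have the form "there is a term `r` such that, for all hypotheses and all parameters, …"; the
term itself is left to unification.

The fixed point combinator `Y` realizes induction along any well-founded relation
(`exists_realizes_induction`).  Induction on the domain relation of `W` gives reflexivity and
transitivity of `=_W`, whence all formulas respect `=_W` (`exists_realizes_interp_congr`), and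
soundness follows by reading a term off a derivation (`exists_realizes_of_derives`), with Peirce's
law as an additional constant in the classical case.

For the axioms one needs sets.  Every function from a bounded subset of `W` to `A` is an element of
`W` (`exists_W`), in particular each level `W_γ` with `γ < κ` and constant value `⊤`.  Such levels
witness Pairing, Union, Powerset, Infinity (`γ = ω`) and Collection.  For Collection, `κ` is used in
full: `W_β` for `β < κ` and `A` have fewer than `κ` elements, so a level `W_γ` contains enough
witnesses for the existential quantifier over `W` to have the same value when it is restricted
to `W_γ` (`exists_level_witnesses`).
-/

namespace ImplicativeAlgebra

/-! ### Realizers -/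

section Realizers

variable {A : Type u} [ImplicativeAlgebra A]

/-- Application `a · b`, the least `c` with `a ≤ b → c`. -/
def app (a b : A) : A := sInf {c | a ≤ imp b c}

theorem app_le_iff {a b c : A} : app a b ≤ c ↔ a ≤ imp b c := by
  refine ⟨fun h => ?_, fun h => sInf_le h⟩
  have : a ≤ imp b (app a b) := by
    rw [app, imp_sInf]
    exact le_iInf₂ fun _ hc => hc
  exact this.trans (imp_mono le_rfl h)

theorem app_mono {a a' b b' : A} (ha : a ≤ a') (hb : b ≤ b') : app a b ≤ app a' b' :=
  app_le_iff.2 (ha.trans ((app_le_iff.1 le_rfl).trans (imp_mono hb le_rfl)))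

theorem app_mem_sep {a b : A} (ha : a ∈ (sep : Set A)) (hb : b ∈ (sep : Set A)) :
    app a b ∈ (sep : Set A) :=
  sep_mp (sep_upward (app_le_iff.1 le_rfl) ha) hb

theorem top_mem_sep : (⊤ : A) ∈ (sep : Set A) := sep_upward le_top sep_K

/-- The combinator `K`. -/
def combK : A := ⨅ a : A, ⨅ b : A, imp a (imp b a)

/-- The combinator `S`. -/
def combS : A := ⨅ a : A, ⨅ b : A, ⨅ c : A,
  imp (imp a (imp b c)) (imp (imp a b) (imp a c))

theorem combK_app_le (a b : A) : app (app combK a) b ≤ a :=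
  app_le_iff.2 (app_le_iff.2 (iInf_le_of_le a (iInf_le _ b)))

theorem combS_app_le (a b c : A) : app (app (app combS a) b) c ≤ app (app a c) (app b c) := by
  refine app_le_iff.2 (app_le_iff.2 (app_le_iff.2 ?_))
  refine (iInf_le_of_le c (iInf_le_of_le (app b c) (iInf_le _ (app (app a c) (app b c))))).trans ?_
  refine imp_mono ?_ (imp_mono ?_ le_rfl)
  · exact app_le_iff.1 (app_le_iff.1 le_rfl)
  · exact app_le_iff.1 le_rfl

/-- Application of an element to the entries of a list, the last entry first. -/
def apps (s : A) : List A → A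
  | [] => s
  | a :: Γ => app (apps s Γ) a

/-- A function of `n` arguments is tracked if a single element of the separator, applied to the
arguments, is a lower bound of its values. -/
def Tracked (n : ℕ) (f : List A → A) : Prop :=
  ∃ s ∈ (sep : Set A), ∀ Γ : List A, Γ.length = n → apps s Γ ≤ f Γ

theorem Tracked.const {s : A} (hs : s ∈ (sep : Set A)) (n : ℕ) : Tracked n fun _ => s := by
  induction n generalizing s with
  | zero => exact ⟨s, hs, fun Γ h => by rw [List.length_eq_zero_iff.1 h]; rfl⟩
  | succ n ih =>
    obtain ⟨r, hr, h⟩ := ih (app_mem_sep sep_K hs)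
    refine ⟨r, hr, fun Γ hΓ => ?_⟩
    obtain ⟨a, Γ, rfl⟩ := List.exists_cons_of_length_eq_add_one hΓ
    exact (app_mono (h Γ (by simpa using hΓ)) le_rfl).trans (combK_app_le s a)

/-- Tracked functions are closed under pointwise application; in the step the last argument is
distributed by the combinator `S`. -/
theorem Tracked.app {n : ℕ} {f g : List A → A} (hf : Tracked n f) (hg : Tracked n g) :
    Tracked n fun Γ => app (f Γ) (g Γ) := by
  induction n generalizing f g with
  | zero =>
    obtain ⟨s, hs, hsf⟩ := hf
    obtain ⟨r, hr, hrg⟩ := hg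
    refine ⟨_, app_mem_sep hs hr, fun Γ h => ?_⟩
    rw [List.length_eq_zero_iff.1 h]
    exact app_mono (hsf [] rfl) (hrg [] rfl)
  | succ n ih =>
    obtain ⟨s, hs, hsf⟩ := hf
    obtain ⟨r, hr, hrg⟩ := hg
    obtain ⟨q, hq, h⟩ := ih (ih (Tracked.const sep_S n) ⟨s, hs, fun Γ _ => le_refl (apps s Γ)⟩)
      ⟨r, hr, fun Γ _ => le_refl (apps r Γ)⟩
    refine ⟨q, hq, fun Γ hΓ => ?_⟩
    obtain ⟨a, Γ, rfl⟩ := List.exists_cons_of_length_eq_add_one hΓ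
    refine (app_mono (h Γ (by simpa using hΓ)) le_rfl).trans ((combS_app_le _ _ _).trans ?_)
    exact app_mono (hsf _ hΓ) (hrg _ hΓ)

/-- Positions beyond the end of the list give `⊤`, so that they need no exception. -/
theorem Tracked.var (n k : ℕ) : Tracked n fun Γ : List A => Γ[k]?.getD ⊤ := by
  induction n generalizing k with
  | zero => exact ⟨⊤, top_mem_sep, fun Γ h => by rw [List.length_eq_zero_iff.1 h]; simp⟩
  | succ n ih =>
    have key : ∀ f : List A → A, Tracked n f →
        (∀ Γ a, ImplicativeAlgebra.app (f Γ) a ≤ (a :: Γ)[k]?.getD ⊤) →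
        Tracked (n + 1) fun Γ : List A => Γ[k]?.getD ⊤ := by
      rintro f ⟨s, hs, h⟩ hf
      refine ⟨s, hs, fun Γ hΓ => ?_⟩
      obtain ⟨a, Γ, rfl⟩ := List.exists_cons_of_length_eq_add_one hΓ
      exact (app_mono (h Γ (by simpa using hΓ)) le_rfl).trans (hf Γ a)
    cases k with
    | zero =>
      -- the identity is `S K K`
      refine key _ (Tracked.const (app_mem_sep (app_mem_sep sep_S sep_K) sep_K) n) fun Γ a => ?_
      exact (combS_app_le _ _ _).trans (combK_app_le _ _)
    | succ k =>
      refine key _ ((Tracked.const sep_K n).app (ih k)) fun Γ a => ?_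
      exact combK_app_le (Γ[k]?.getD ⊤) a

variable (A) in
/-- Untyped λ-terms in de Bruijn notation, with constants from the separator. -/
inductive Term : Type u
  | var (k : ℕ)
  | const (s : A) (hs : s ∈ (sep : Set A))
  | app (t s : Term)
  | lam (t : Term)

namespace Term

/-- The value of a λ-term in an environment.  A variable that is out of range has the value `⊤`,
which is in the separator. -/
def eval : Term A → List A → A
  | var k, Γ => Γ[k]?.getD ⊤
  | const s _, _ => s
  | app t s, Γ => ImplicativeAlgebra.app (eval t Γ) (eval s Γ)
  | lam t, Γ => ⨅ a : A, imp a (eval t (a :: Γ))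

/-- Combinatory completeness: λ-abstraction is absorbed by reading a function of `n + 1` arguments
as a function of `n` arguments. -/
theorem tracked_eval (t : Term A) (n : ℕ) : Tracked n t.eval := by
  induction t generalizing n with
  | var k => exact Tracked.var n k
  | const s hs => exact Tracked.const hs n
  | app t s iht ihs => exact (iht n).app (ihs n)
  | lam t ih =>
    obtain ⟨s, hs, h⟩ := ih (n + 1)
    refine ⟨s, hs, fun Γ hΓ => le_iInf fun a => app_le_iff.1 ?_⟩
    exact h (a :: Γ) (by simpa using hΓ)

theorem eval_nil_mem_sep (t : Term A) : t.eval [] ∈ (sep : Set A) := by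
  obtain ⟨s, hs, h⟩ := t.tracked_eval 0
  exact sep_upward (h [] rfl) hs

end Term

/-! ### Natural deduction for realizers -/

/-- The term `t` realizes `a` under the hypotheses `Γ`.  Since every element of `A` is at the same
time a truth value and its own best realizer, the list `Γ` of hypotheses serves as environment. -/
def Realizes (Γ : List A) (t : Term A) (a : A) : Prop := t.eval Γ ≤ a

namespace Realizes

variable {Γ : List A} {t s r : Term A} {a b c : A}

theorem mono (h : Realizes Γ t a) (hab : a ≤ b) : Realizes Γ t b := le_trans h hab

theorem var (k : ℕ) (h : Γ[k]? = some a) : Realizes Γ (.var k) a := by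
  simp [Realizes, Term.eval, h]

theorem const (ha : a ∈ (sep : Set A)) : Realizes Γ (.const a ha) a := le_refl a

/-- Any term realizes `⊤`; the variable is a dummy. -/
theorem top : Realizes Γ (.var 0) ⊤ := le_top

/-- Since `⋀ a, (a → t[a])` is below its instance at the hypothesis `a` itself, it suffices to type
the body with the best realizer of the hypothesis. -/
theorem lam (h : Realizes (a :: Γ) t b) : Realizes Γ (.lam t) (imp a b) :=
  (iInf_le _ a).trans (imp_mono le_rfl h)

theorem app (h : Realizes Γ t (imp a b)) (h' : Realizes Γ s a) : Realizes Γ (.app t s) b :=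
  app_le_iff.2 (h.trans (imp_mono h' le_rfl))

/-- A quantified statement has the same realizers as all its instances: universal quantification
leaves no trace in the term, which has to be uniform. -/
theorem all {ι : Sort*} {f : ι → A} (h : ∀ i, Realizes Γ t (f i)) : Realizes Γ t (⨅ i, f i) :=
  le_iInf h

theorem inst {ι : Sort*} {f : ι → A} (h : Realizes Γ t (⨅ i, f i)) (i : ι) :
    Realizes Γ t (f i) :=
  h.mono (iInf_le f i)

theorem botE (h : Realizes Γ t ⊥) : Realizes Γ t a := h.mono bot_le

end Realizes

/-- The realizer of a conjunction built from realizers of its parts. -/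
def Term.pair (t s : Term A) : Term A :=
  .app (.app (.lam (.lam (.lam (.app (.app (.var 0) (.var 2)) (.var 1))))) t) s

/-- Elimination of a conjunction: the two parts are bound to the variables `1` and `0` of `s`. -/
def Term.letPair (t s : Term A) : Term A := .app t (.lam (.lam s))

/-- The realizer of a disjunction built from a realizer of the left part. -/
def Term.inl (t : Term A) : Term A := .app (.lam (.lam (.lam (.app (.var 1) (.var 2))))) t

/-- The realizer of a disjunction built from a realizer of the right part. -/
def Term.inr (t : Term A) : Term A := .app (.lam (.lam (.lam (.app (.var 0) (.var 2))))) t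

/-- Elimination of a disjunction. -/
def Term.cases (t s r : Term A) : Term A := .app (.app t (.lam s)) (.lam r)

/-- The realizer of an existential statement built from a realizer of an instance. -/
def Term.wit (t : Term A) : Term A := .app (.lam (.lam (.app (.var 0) (.var 1)))) t

/-- Elimination of an existential statement. -/
def Term.letWit (t s : Term A) : Term A := .app t (.lam s)

/-- Elimination of a bounded existential statement `∃ i, a i × b i`: realizers of `a i` and `b i`
are bound to the variables `1` and `0` of `s`. -/
def Term.letBex (t s : Term A) : Term A :=
  .app (.app (.lam (.lam (.app (.var 1) (.lam (.app (.var 0) (.var 1)))))) t) (.lam (.lam s))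

namespace Realizes

variable {Γ : List A} {t s r : Term A} {a b c : A}

theorem pair (h : Realizes Γ t a) (h' : Realizes Γ s b) : Realizes Γ (.pair t s) (conj a b) :=
  .app (.app (.lam (.lam (.all fun _ =>
    .lam (.app (.app (.var 0 rfl) (.var 2 rfl)) (.var 1 rfl))))) h) h'

theorem conjE (h : Realizes Γ t (conj a b)) (h' : Realizes Γ s (imp a (imp b c))) :
    Realizes Γ (.app t s) c :=
  .app (h.inst c) h'

theorem letPair (h : Realizes Γ t (conj a b)) (h' : Realizes (b :: a :: Γ) s c) :
    Realizes Γ (.letPair t s) c :=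
  h.conjE (.lam (.lam h'))

theorem fst (h : Realizes Γ t (conj a b)) : Realizes Γ (.letPair t (.var 1)) a :=
  h.letPair (.var 1 rfl)

theorem snd (h : Realizes Γ t (conj a b)) : Realizes Γ (.letPair t (.var 0)) b :=
  h.letPair (.var 0 rfl)

theorem inl (h : Realizes Γ t a) : Realizes Γ (.inl t) (disj a b) :=
  .app (.lam (.all fun _ => .lam (.lam (.app (.var 1 rfl) (.var 2 rfl))))) h

theorem inr (h : Realizes Γ t b) : Realizes Γ (.inr t) (disj a b) :=
  .app (.lam (.all fun _ => .lam (.lam (.app (.var 0 rfl) (.var 2 rfl))))) h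

theorem cases (h : Realizes Γ t (disj a b)) (hs : Realizes (a :: Γ) s c)
    (hr : Realizes (b :: Γ) r c) : Realizes Γ (.cases t s r) c :=
  .app (.app (h.inst c) (.lam hs)) (.lam hr)

theorem wit {ι : Type*} {f : ι → A} (i : ι) (h : Realizes Γ t (f i)) :
    Realizes Γ (.wit t) (exi f) :=
  .app (.lam (.all fun x =>
    .lam (.app (.inst (f := fun i => imp (f i) x) (.var 0 rfl) i) (.var 1 rfl)))) h

theorem letWit {ι : Type*} {f : ι → A} (h : Realizes Γ t (exi f))
    (h' : ∀ i, Realizes (f i :: Γ) s c) : Realizes Γ (.letWit t s) c :=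
  .app (h.inst c) (.all fun i => .lam (h' i))

theorem letBex {ι : Type*} {f g : ι → A} (h : Realizes Γ t (exi fun i => conj (f i) (g i)))
    (h' : ∀ i, Realizes (g i :: f i :: Γ) s c) : Realizes Γ (.letBex t s) c :=
  .app (a := ⨅ i, imp (f i) (imp (g i) c))
    (.app (.lam (.lam (.letWit (.var 1 rfl) fun i =>
      .conjE (.var 0 rfl) (.inst (f := fun i => imp (f i) (imp (g i) c)) (.var 1 rfl) i)))) h)
    (.all fun i => .lam (.lam (h' i)))

end Realizes

/-- Well-founded induction is realized, uniformly in the predicate, by a fixed point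
combinator. -/
theorem exists_realizes_induction {ι : Type*} {R : ι → ι → Prop} (hR : WellFounded R) :
    ∃ t : Term A, ∀ (Γ : List A) (f : ι → A),
      Realizes Γ t (imp (⨅ i, imp (⨅ j : {j // R j i}, f j) (f i)) (⨅ i, f i)) := by
  -- `Y = λ f, (λ x, f (x x)) (λ x, f (x x))`
  let w : Term A := .lam (.app (.var 1) (.app (.var 0) (.var 0)))
  refine ⟨.lam (.app w w), fun Γ f => .lam (.all fun i => ?_)⟩
  induction i using hR.induction with
  | h i ih =>
    have step : (Term.app w w).eval ((⨅ i, imp (⨅ j : {j // R j i}, f j) (f i)) :: Γ) ≤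
        app (⨅ i, imp (⨅ j : {j // R j i}, f j) (f i))
          ((Term.app w w).eval ((⨅ i, imp (⨅ j : {j // R j i}, f j) (f i)) :: Γ)) :=
      app_le_iff.2 (iInf_le _ (w.eval _))
    exact step.trans (app_le_iff.2 ((iInf_le _ i).trans
      (imp_mono (le_iInf fun j => ih j.1 j.2) le_rfl)))

end Realizers

end ImplicativeAlgebra

namespace ImpModel

open ImplicativeAlgebra

/-! ### The hierarchy below an inaccessible cardinal -/

section Hierarchy

variable {A : Type u} {e : A ↪ ZFSet.{u}} {κ : Cardinal.{u}}

theorem hierarchy_mono {α β : Ordinal.{u}} (h : α ≤ β) : hierarchy e α ⊆ hierarchy e β := by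
  induction β using Ordinal.limitRecOn with
  | zero =>
    rw [nonpos_iff_eq_zero.1 h]
  | add_one β ih =>
    rcases h.lt_or_eq with h | rfl
    · exact fun x hx => hierarchy_subset_succ β (ih (Order.lt_add_one_iff.1 h) hx)
    · exact fun _ hx => hx
  | limit β hβ ih =>
    rcases h.lt_or_eq with h | rfl
    · exact fun x hx => (mem_hierarchy_limit hβ).2 ⟨α, h, hx⟩
    · exact fun _ hx => hx

theorem card_partialFunctions_le (X : ZFSet.{u}) :
    (partialFunctions e X).card ≤ 2 ^ (X.card * Cardinal.mk A) := by
  have h1 : (partialFunctions e X).card ≤ (ZFSet.powerset (ZFSet.prod X (ZFSet.range e))).card :=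
    ZFSet.card_mono fun x hx => (ZFSet.mem_sep.1 hx).1
  have h2 : (ZFSet.prod X (ZFSet.range e)).card ≤ X.card * Cardinal.mk A := by
    let f : Shrink.{u} X × A → ZFSet.{u} := fun p =>
      ZFSet.pair ((equivShrink X).symm p.1).1 (e p.2)
    have h3 := ZFSet.lift_card_range_le (f := f)
    rw [Cardinal.lift_id, Cardinal.lift_id] at h3
    refine (ZFSet.card_mono fun x hx => ?_).trans (h3.trans_eq ?_)
    · obtain ⟨a, ha, b, hb, rfl⟩ := ZFSet.mem_prod.1 hx
      obtain ⟨b, rfl⟩ := ZFSet.mem_range.1 hb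
      exact ZFSet.mem_range.2 ⟨(equivShrink X ⟨a, ha⟩, b), by simp [f]⟩
    · rw [Cardinal.mk_prod, Cardinal.lift_id, Cardinal.lift_id]
      rfl
  rw [ZFSet.card_powerset] at h1
  exact h1.trans (Cardinal.power_le_power_left two_ne_zero h2)

theorem card_hierarchy_lt (hκ : κ.IsInaccessible) (hA : Cardinal.mk A < κ) {α : Ordinal.{u}}
    (hα : α < κ.ord) : (hierarchy e α).card < κ := by
  induction α using Ordinal.limitRecOn with
  | zero =>
    rw [hierarchy_zero, ZFSet.card_empty]
    exact hκ.pos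
  | add_one α ih =>
    rw [hierarchy_succ]
    refine (card_partialFunctions_le _).trans_lt (hκ.isStrongPrelimit ?_)
    exact Cardinal.mul_lt_of_lt hκ.aleph0_lt.le
      (ih ((Order.lt_add_one_iff.2 le_rfl).trans hα)) hA
  | limit α hlim ih =>
    let f : α.ToType → ZFSet.{u} := fun i => hierarchy e (i.toOrd : Set.Iio α).1
    have h1 := ZFSet.lift_card_iUnion_le_sum_card (f := f)
    rw [Cardinal.lift_id] at h1
    refine (ZFSet.card_mono fun x hx => ?_).trans_lt (h1.trans_lt ?_)
    · obtain ⟨β, hβ, hx⟩ := (mem_hierarchy_limit hlim).1 hx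
      exact ZFSet.mem_iUnion.2 ⟨Ordinal.ToType.mk ⟨β, hβ⟩, by simpa [f] using hx⟩
    · refine Cardinal.sum_lt_of_isRegular hκ.isRegular ?_ fun i => ih _ i.toOrd.2
        (lt_trans i.toOrd.2 hα)
      rw [Cardinal.mk_toType]
      exact Cardinal.lt_ord.1 hα

theorem isSuccLimit_ord (hκ : κ.IsInaccessible) : Order.IsSuccLimit κ.ord :=
  Cardinal.isSuccLimit_ord hκ.aleph0_lt.le

theorem W.exists_level (hκ : κ.IsInaccessible) (α : W e κ) :
    ∃ γ < κ.ord, α.1 ∈ hierarchy e γ :=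
  (mem_hierarchy_limit (isSuccLimit_ord hκ)).1 α.2

theorem mem_hierarchy_of_mem_dom {γ : Ordinal.{u}} {α t : W e κ} (hα : α.1 ∈ hierarchy e γ)
    (ht : t ∈ dom α) : t.1 ∈ hierarchy e γ :=
  let ⟨_, h⟩ := ht
  mem_hierarchy_of_pair hα h

/-- A function that is defined on a bounded set of elements of `W` is an element of `W`. -/
theorem exists_W (hκ : κ.IsInaccessible) {γ : Ordinal.{u}} (hγ : γ < κ.ord) (D : Set (W e κ))
    (hD : ∀ t ∈ D, t.1 ∈ hierarchy e γ) (g : W e κ → A) :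
    ∃ α : W e κ, α.1 ∈ hierarchy e (γ + 1) ∧ dom α = D ∧ ∀ t : dom α, val α t = g t.1 := by
  let f : ZFSet.{u} := ZFSet.sep (fun p => ∃ t ∈ D, p = ZFSet.pair t.1 (e (g t)))
    (ZFSet.prod (hierarchy e γ) (ZFSet.range e))
  have mem_f : ∀ p, p ∈ f ↔ ∃ t ∈ D, p = ZFSet.pair t.1 (e (g t)) := by
    refine fun p => ZFSet.mem_sep.trans (and_iff_right_of_imp ?_)
    rintro ⟨t, ht, rfl⟩
    exact ZFSet.pair_mem_prod.2 ⟨hD t ht, ZFSet.mem_range.2 ⟨_, rfl⟩⟩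
  have pair_mem_f : ∀ (t : W e κ) (y : ZFSet.{u}),
      ZFSet.pair t.1 y ∈ f ↔ t ∈ D ∧ y = e (g t) := by
    intro t y
    rw [mem_f]
    constructor
    · rintro ⟨s, hs, h⟩
      obtain ⟨h1, rfl⟩ := ZFSet.pair_inj.1 h
      obtain rfl := Subtype.ext h1
      exact ⟨hs, rfl⟩
    · rintro ⟨ht, rfl⟩
      exact ⟨t, ht, rfl⟩
  have hf : f ∈ hierarchy e (γ + 1) := by
    rw [hierarchy_succ, mem_partialFunctions]
    constructor
    · intro p hp
      obtain ⟨t, ht, rfl⟩ := (mem_f p).1 hp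
      exact ⟨t.1, hD t ht, _, rfl⟩
    · intro x y y' h h'
      obtain ⟨t, ht, hp⟩ := (mem_f _).1 h
      obtain ⟨rfl, rfl⟩ := ZFSet.pair_inj.1 hp
      exact ((pair_mem_f t y').1 h').2.symm
  let α : W e κ := ⟨f, hierarchy_mono ((isSuccLimit_ord hκ).add_one_lt hγ).le hf⟩
  refine ⟨α, hf, Set.ext fun t => ?_, fun t => ?_⟩
  · constructor
    · rintro ⟨a, h⟩
      exact ((pair_mem_f t _).1 h).1
    · exact fun h => ⟨g t, (pair_mem_f t _).2 ⟨h, rfl⟩⟩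
  · exact e.injective ((pair_mem_f t.1 _).1 (pair_val_mem α t)).2

/-- Families of fewer than `κ` elements of `W` are bounded. -/
theorem exists_level_of_lift_mk_lt (hκ : κ.IsInaccessible) {ι : Type (u + 1)}
    (hι : Cardinal.mk ι < Cardinal.lift.{u + 1} κ) (f : ι → W e κ) :
    ∃ γ < κ.ord, ∀ i, (f i).1 ∈ hierarchy e γ := by
  choose β hβ hf using fun i => (f i).exists_level hκ
  refine ⟨⨆ i, β i, Ordinal.lift_iSup_lt_of_lt_cof ?_ hβ, fun i => ?_⟩
  · rw [← Ordinal.lift_cof, hκ.isRegular.cof_ord]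
    rwa [Cardinal.lift_id'.{u, u + 1}]
  · refine hierarchy_mono (le_ciSup ⟨κ.ord, ?_⟩ i) (hf i)
    rintro _ ⟨i, rfl⟩
    exact (hβ i).le

theorem mk_dom_lt (hκ : κ.IsInaccessible) (hA : Cardinal.mk A < κ) (α : W e κ) :
    Cardinal.mk (dom α) < Cardinal.lift.{u + 1} κ := by
  obtain ⟨γ, hγ, hα⟩ := α.exists_level hκ
  have h : Cardinal.mk (dom α) ≤ Cardinal.mk (hierarchy e γ) :=
    Cardinal.mk_le_of_injective
      (f := fun t : dom α => (⟨t.1.1, mem_hierarchy_of_mem_dom hα t.2⟩ : hierarchy e γ))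
      fun s t h => Subtype.ext (Subtype.ext (Subtype.mk.inj h))
  refine h.trans_lt ?_
  rw [ZFSet.cardinalMk_coe_sort, Cardinal.lift_lt]
  exact card_hierarchy_lt hκ hA hγ

/-- Since `A` and the domain of `α` have fewer than `κ` elements, some level of the hierarchy
contains witnesses for all the values of a family of functions `W → A` indexed by this domain. -/
theorem exists_level_witnesses (hκ : κ.IsInaccessible) (hA : Cardinal.mk A < κ) (α : W e κ)
    (F : dom α → W e κ → A) :
    ∃ γ < κ.ord, ∀ t β, ∃ β' : W e κ, β'.1 ∈ hierarchy e γ ∧ F t β' = F t β := by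
  let ι := {p : dom α × A // ∃ β, F p.1 β = p.2}
  have hι : Cardinal.mk ι < Cardinal.lift.{u + 1} κ := by
    refine (Cardinal.mk_subtype_le _).trans_lt ?_
    rw [Cardinal.mk_prod, Cardinal.lift_id'.{u, u + 1}]
    refine Cardinal.mul_lt_of_lt ?_ (mk_dom_lt hκ hA α) (Cardinal.lift_lt.2 hA)
    exact Cardinal.aleph0_le_lift.2 hκ.aleph0_lt.le
  obtain ⟨γ, hγ, h⟩ := exists_level_of_lift_mk_lt hκ hι fun i => i.2.choose
  exact ⟨γ, hγ, fun t β =>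
    ⟨_, h ⟨(t, F t β), β, rfl⟩, Exists.choose_spec (p := fun b => F t b = F t β) _⟩⟩

end Hierarchy

end ImpModel

namespace ImpModel

open ImplicativeAlgebra

/-! ### Equality and membership -/

section Equality

variable {A : Type u} {e : A ↪ ZFSet.{u}} {κ : Cardinal.{u}} [ImplicativeAlgebra A]

/-- Inclusion `α ⊆_W β := ∀ t ∈ ∂₀(α), α(t) → t ∈_W β`. -/
noncomputable def subW (α β : W e κ) : A := ⨅ t : dom α, imp (val α t) (memW t.1 β)

variable {Γ : List A} {t p q : Term A} {α β γ : W e κ} {a : A}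

/-! The recursive definitions of `∈_W` and `=_W`, as introduction and elimination rules. -/

theorem realizes_eqW (h : Realizes Γ p (subW α β)) (h' : Realizes Γ q (subW β α)) :
    Realizes Γ (.pair p q) (eqW α β) := by
  rw [eqW]
  exact h.pair h'

theorem realizes_subW_of_eqW (h : Realizes Γ t (eqW α β)) :
    Realizes Γ (.letPair t (.var 1)) (subW α β) := by
  rw [eqW] at h
  exact h.fst

theorem realizes_subW_of_eqW' (h : Realizes Γ t (eqW α β)) :
    Realizes Γ (.letPair t (.var 0)) (subW β α) := by
  rw [eqW] at h
  exact h.snd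

theorem realizes_memW (x : dom β) (h : Realizes Γ p (val β x)) (h' : Realizes Γ q (eqW x.1 α)) :
    Realizes Γ (.wit (.pair p q)) (memW α β) := by
  rw [memW]
  exact .wit x (h.pair h')

theorem realizes_of_memW (h : Realizes Γ t (memW α β))
    (h' : ∀ x : dom β, Realizes (eqW x.1 α :: val β x :: Γ) p a) :
    Realizes Γ (.letBex t p) a := by
  rw [memW] at h
  exact h.letBex h'

theorem realizes_memW_of_subW (x : dom α) (h : Realizes Γ p (subW α β))
    (h' : Realizes Γ q (val α x)) : Realizes Γ (.app p q) (memW x.1 β) :=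
  .app (h.mono (iInf_le _ x)) h'

variable (e κ)

theorem exists_realizes_eqW_refl :
    ∃ r : Term A, ∀ (Γ : List A) (α : W e κ), Realizes Γ r (eqW α α) := by
  obtain ⟨y, hy⟩ := exists_realizes_induction (A := A) (wellFounded_dom (e := e) (κ := κ))
  have key : ∃ s : Term A, ∀ (Γ : List A) (α : W e κ),
      Realizes ((⨅ t : dom α, eqW t.1 t.1) :: Γ) s (subW α α) :=
    ⟨_, fun Γ α => .all fun t => .lam <|
      realizes_memW t (.var 0 rfl) ((Realizes.var 1 rfl).mono (iInf_le _ t))⟩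
  obtain ⟨s, hs⟩ := key
  exact ⟨_, fun Γ α => ((hy Γ fun α => eqW α α).app
    (.all fun α => .lam (realizes_eqW (hs Γ α) (hs Γ α)))).mono (iInf_le _ α)⟩

theorem exists_realizes_eqW_symm : ∃ r : Term A, ∀ (Γ : List A) (α β : W e κ),
    Realizes Γ r (imp (eqW α β) (eqW β α)) :=
  ⟨_, fun _ _ _ => .lam <| realizes_eqW (realizes_subW_of_eqW' (.var 0 rfl))
    (realizes_subW_of_eqW (.var 0 rfl))⟩

/-- Transitivity of `=_W` is proved by induction on the middle element, for all outer elements at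
once: then the induction hypothesis serves both inclusions. -/
theorem exists_realizes_eqW_trans : ∃ r : Term A, ∀ (Γ : List A) (α β γ : W e κ),
    Realizes Γ r (imp (eqW α β) (imp (eqW β γ) (eqW α γ))) := by
  obtain ⟨y, hy⟩ := exists_realizes_induction (A := A) (wellFounded_dom (e := e) (κ := κ))
  let T : W e κ → A := fun β => ⨅ α : W e κ, ⨅ γ : W e κ,
    imp (eqW α β) (imp (eqW β γ) (eqW α γ))
  have key : ∃ s : Term A, ∀ (Γ : List A) (α β γ : W e κ),
      Realizes Γ s (imp (⨅ t : dom β, T t.1) (imp (subW α β) (imp (subW β γ) (subW α γ)))) :=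
    ⟨_, fun Γ α β γ => .lam <| .lam <| .lam <| .all fun u => .lam <|
      realizes_of_memW (realizes_memW_of_subW u (.var 2 rfl) (.var 0 rfl)) fun t =>
      realizes_of_memW (realizes_memW_of_subW t (.var 3 rfl) (.var 1 rfl)) fun s =>
      realizes_memW s (.var 1 rfl) <| .app (.app
        ((Realizes.var 7 rfl).mono ((iInf_le _ t).trans (iInf_le_of_le s.1 (iInf_le _ u.1))))
        (.var 0 rfl)) (.var 2 rfl)⟩
  obtain ⟨s, hs⟩ := key
  exact ⟨_, fun Γ α β γ => ((hy Γ T).app (.all fun β => .lam <| .all fun α => .all fun γ =>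
    .lam <| .lam <| realizes_eqW
      (.app (.app (.app (hs _ α β γ) (.var 2 rfl)) (realizes_subW_of_eqW (.var 1 rfl)))
        (realizes_subW_of_eqW (.var 0 rfl)))
      (.app (.app (.app (hs _ γ β α) (.var 2 rfl)) (realizes_subW_of_eqW' (.var 0 rfl)))
        (realizes_subW_of_eqW' (.var 1 rfl))))).mono
    (iInf_le_of_le β (iInf_le_of_le α (iInf_le _ γ)))⟩

theorem exists_realizes_memW_congr_left : ∃ r : Term A, ∀ (Γ : List A) (α α' β : W e κ),
    Realizes Γ r (imp (eqW α α') (imp (memW α β) (memW α' β))) := by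
  obtain ⟨r, hr⟩ := exists_realizes_eqW_trans (A := A) e κ
  exact ⟨_, fun Γ α α' β => .lam <| .lam <| realizes_of_memW (.var 0 rfl) fun t =>
    realizes_memW t (.var 1 rfl) (.app (.app (hr _ t.1 α α') (.var 0 rfl)) (.var 3 rfl))⟩

/-- If `t = α` for a `t` in the domain of `β`, and `β = β'`, then `t ∈ β'`, hence `α ∈ β'`. -/
theorem exists_realizes_memW_congr_right : ∃ r : Term A, ∀ (Γ : List A) (α β β' : W e κ),
    Realizes Γ r (imp (eqW β β') (imp (memW α β) (memW α β'))) := by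
  obtain ⟨r, hr⟩ := exists_realizes_memW_congr_left (A := A) e κ
  exact ⟨_, fun Γ α β β' => .lam <| .lam <| realizes_of_memW (.var 0 rfl) fun t =>
    .app (.app (hr _ t.1 α β') (.var 0 rfl))
      (realizes_memW_of_subW t (realizes_subW_of_eqW (.var 3 rfl)) (.var 1 rfl))⟩

/-- The values of a function are true members of it. -/
theorem exists_realizes_memW_of_val : ∃ r : Term A, ∀ (Γ : List A) (α : W e κ) (t : dom α),
    Realizes Γ r (imp (val α t) (memW t.1 α)) := by
  obtain ⟨r, hr⟩ := exists_realizes_eqW_refl (A := A) e κ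
  exact ⟨_, fun Γ α t => .lam <| realizes_memW t (.var 0 rfl) (hr _ t.1)⟩

end Equality

/-! ### Formulas -/

section Formulas

variable {A : Type u} {e : A ↪ ZFSet.{u}} {κ : Cardinal.{u}} [ImplicativeAlgebra A]

theorem interp_subst {m n : ℕ} (f : Fin m → Fin n) (φ : SetFormula m) (v : Fin n → W e κ) :
    interp (φ.subst f) v = interp φ (v ∘ f) := by
  have cons_comp : ∀ {m n : ℕ} (f : Fin m → Fin n) (v : Fin n → W e κ) (β : W e κ),
      (Fin.cons β v : Fin (n + 1) → W e κ) ∘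
        (Fin.cons 0 fun i => (f i).succ : Fin (m + 1) → Fin (n + 1)) = Fin.cons β (v ∘ f) := by
    intro m n f v β
    funext i
    refine Fin.cases ?_ (fun i => ?_) i <;> simp
  induction φ generalizing n with
  | mem i j => rfl
  | eq i j => rfl
  | bot => rfl
  | and φ ψ ihφ ihψ => simp only [SetFormula.subst, interp, ihφ, ihψ]
  | or φ ψ ihφ ihψ => simp only [SetFormula.subst, interp, ihφ, ihψ]
  | imp φ ψ ihφ ihψ => simp only [SetFormula.subst, interp, ihφ, ihψ]
  | ex φ ih => simp only [SetFormula.subst, interp, ih, cons_comp]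
  | all φ ih => simp only [SetFormula.subst, interp, ih, cons_comp]

theorem interp_weaken {n : ℕ} (φ : SetFormula n) (v : Fin n → W e κ) (β : W e κ) :
    interp φ.weaken (Fin.cons β v : Fin (n + 1) → W e κ) = interp φ v := by
  rw [SetFormula.weaken, interp_subst]
  congr 1

theorem interp_inst {n : ℕ} (φ : SetFormula (n + 1)) (i : Fin n) (v : Fin n → W e κ) :
    interp (φ.inst i) v = interp φ (Fin.cons (v i) v : Fin (n + 1) → W e κ) := by
  rw [SetFormula.inst, interp_subst]
  congr 1
  funext j
  refine Fin.cases ?_ (fun j => ?_) j <;> simp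

variable (e κ) in
/-- Formulas respect equality, in one variable at a time. -/
theorem exists_realizes_interp_congr {n : ℕ} (φ : SetFormula n) (i : Fin n) :
    ∃ r : Term A, ∀ (Γ : List A) (v w : Fin n → W e κ), (∀ j, j ≠ i → v j = w j) →
      Realizes Γ r (imp (eqW (v i) (w i)) (imp (interp φ v) (interp φ w))) := by
  obtain ⟨refl, hrefl⟩ := exists_realizes_eqW_refl (A := A) e κ
  obtain ⟨symm, hsymm⟩ := exists_realizes_eqW_symm (A := A) e κ
  obtain ⟨trans, htrans⟩ := exists_realizes_eqW_trans (A := A) e κ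
  obtain ⟨left, hleft⟩ := exists_realizes_memW_congr_left (A := A) e κ
  obtain ⟨right, hright⟩ := exists_realizes_memW_congr_right (A := A) e κ
  have hvar : ∀ {n : ℕ} (i k : Fin n), ∃ r : Term A, ∀ (Γ : List A) (v w : Fin n → W e κ),
      (∀ j, j ≠ i → v j = w j) → Realizes Γ r (imp (eqW (v i) (w i)) (eqW (v k) (w k))) := by
    intro n i k
    by_cases hk : k = i
    · subst hk
      exact ⟨_, fun Γ v w h => .lam (.var 0 rfl)⟩
    · refine ⟨.lam refl, fun Γ v w h => .lam ?_⟩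
      rw [h k hk]
      exact hrefl _ _
  have cons_agree : ∀ {n : ℕ} {i : Fin n} {v w : Fin n → W e κ} (β : W e κ),
      (∀ j, j ≠ i → v j = w j) → ∀ j, j ≠ i.succ →
        (Fin.cons β v : Fin (n + 1) → W e κ) j = (Fin.cons β w : Fin (n + 1) → W e κ) j := by
    intro n i v w β h j
    refine Fin.cases (fun _ => rfl) (fun j hj => ?_) j
    simpa using h j fun hji => hj (congrArg Fin.succ hji)
  induction φ with
  | mem a b =>
    obtain ⟨ra, ha⟩ := hvar i a
    obtain ⟨rb, hb⟩ := hvar i b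
    exact ⟨_, fun Γ v w h => .lam <| .lam <|
      .app (.app (hright _ (w a) (v b) (w b)) (.app (hb _ v w h) (.var 1 rfl))) <|
      .app (.app (hleft _ (v a) (w a) (v b)) (.app (ha _ v w h) (.var 1 rfl))) (.var 0 rfl)⟩
  | eq a b =>
    obtain ⟨ra, ha⟩ := hvar i a
    obtain ⟨rb, hb⟩ := hvar i b
    exact ⟨_, fun Γ v w h => .lam <| .lam <|
      .app (.app (htrans _ (w a) (v a) (w b))
        (.app (hsymm _ (v a) (w a)) (.app (ha _ v w h) (.var 1 rfl)))) <|
      .app (.app (htrans _ (v a) (v b) (w b)) (.var 0 rfl)) (.app (hb _ v w h) (.var 1 rfl))⟩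
  | bot => exact ⟨_, fun Γ v w h => .lam (.lam (.var 0 rfl))⟩
  | and φ ψ ihφ ihψ =>
    obtain ⟨r, hr⟩ := ihφ i
    obtain ⟨s, hs⟩ := ihψ i
    exact ⟨_, fun Γ v w h => .lam <| .lam <| .letPair (.var 0 rfl) <| .pair
      (.app (.app (hr _ v w h) (.var 3 rfl)) (.var 1 rfl))
      (.app (.app (hs _ v w h) (.var 3 rfl)) (.var 0 rfl))⟩
  | or φ ψ ihφ ihψ =>
    obtain ⟨r, hr⟩ := ihφ i
    obtain ⟨s, hs⟩ := ihψ i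
    exact ⟨_, fun Γ v w h => .lam <| .lam <| .cases (.var 0 rfl)
      (.inl (.app (.app (hr _ v w h) (.var 2 rfl)) (.var 0 rfl)))
      (.inr (.app (.app (hs _ v w h) (.var 2 rfl)) (.var 0 rfl)))⟩
  | imp φ ψ ihφ ihψ =>
    obtain ⟨r, hr⟩ := ihφ i
    obtain ⟨s, hs⟩ := ihψ i
    exact ⟨_, fun Γ v w h => .lam <| .lam <| .lam <|
      .app (.app (hs _ v w h) (.var 2 rfl)) <| .app (.var 1 rfl) <|
      .app (.app (hr _ w v fun j hj => (h j hj).symm)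
        (.app (hsymm _ (v i) (w i)) (.var 2 rfl))) (.var 0 rfl)⟩
  | ex φ ih =>
    obtain ⟨r, hr⟩ := ih i.succ
    exact ⟨_, fun Γ v w h => .lam <| .lam <| .letWit (.var 0 rfl) fun β => .wit β <|
      .app (.app (hr _ (Fin.cons β v) (Fin.cons β w) (cons_agree β h)) (.var 2 rfl)) (.var 0 rfl)⟩
  | all φ ih =>
    obtain ⟨r, hr⟩ := ih i.succ
    exact ⟨_, fun Γ v w h => .lam <| .lam <| .all fun β =>
      .app (.app (hr _ (Fin.cons β v) (Fin.cons β w) (cons_agree β h)) (.var 1 rfl))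
        ((Realizes.var 0 rfl).mono (iInf_le _ β))⟩

end Formulas

end ImpModel

namespace ImpModel

open ImplicativeAlgebra

/-! ### The axioms -/

section Axioms

variable {A : Type u} {e : A ↪ ZFSet.{u}} {κ : Cardinal.{u}} [ImplicativeAlgebra A]

theorem interp_mem_sep {φ : SetFormula 0} {v : Fin 0 → W e κ}
    (h : ∃ r : Term A, Realizes [] r (interp φ v)) : interp φ v ∈ (sep : Set A) :=
  let ⟨r, hr⟩ := h
  sep_upward hr r.eval_nil_mem_sep

theorem interp_closure_mem_sep {n : ℕ} {φ : SetFormula n} {v : Fin 0 → W e κ}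
    (h : ∃ r : Term A, ∀ w : Fin n → W e κ, Realizes [] r (interp φ w)) :
    interp φ.closure v ∈ (sep : Set A) := by
  induction n with
  | zero =>
    obtain ⟨r, hr⟩ := h
    exact interp_mem_sep ⟨r, hr v⟩
  | succ n ih =>
    obtain ⟨r, hr⟩ := h
    exact ih ⟨r, fun w => .all fun β => hr (Fin.cons β w)⟩

variable (e κ) in
/-- Membership in a function at an argument of value `⊤` is realized uniformly, with no
hypothesis. -/
theorem exists_realizes_memW_of_val_eq_top : ∃ r : Term A, ∀ (Γ : List A) (u α : W e κ),
    (∃ t : dom u, t.1 = α ∧ val u t = ⊤) → Realizes Γ r (memW α u) := by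
  obtain ⟨r, hr⟩ := exists_realizes_memW_of_val (A := A) e κ
  refine ⟨.app r (.var 0), ?_⟩
  rintro Γ u _ ⟨t, rfl, ht⟩
  exact .app (hr Γ u t) (ht ▸ Realizes.top)

/-- Each level `W_γ` with `γ < κ` is an element of `W`, as the function with constant value
`⊤`. -/
theorem exists_level_set (hκ : κ.IsInaccessible) {γ : Ordinal.{u}} (hγ : γ < κ.ord) :
    ∃ u : W e κ, (∀ t : dom u, t.1.1 ∈ hierarchy e γ) ∧
      ∀ α : W e κ, α.1 ∈ hierarchy e γ → ∃ t : dom u, t.1 = α ∧ val u t = ⊤ := by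
  obtain ⟨u, -, hdom, hval⟩ := exists_W hκ hγ {t : W e κ | t.1 ∈ hierarchy e γ}
    (fun _ h => h) fun _ => ⊤
  refine ⟨u, fun t => hdom.le t.2, fun α hα => ⟨⟨α, hdom.ge hα⟩, rfl, hval _⟩⟩

theorem interp_axExt_mem_sep : interp SetFormula.axExt (Fin.elim0 : Fin 0 → W e κ) ∈
    (sep : Set A) := by
  obtain ⟨r, hr⟩ := exists_realizes_memW_of_val (A := A) e κ
  have sub : ∀ {p : Term A} {Γ : List A} {α β : W e κ},
      Realizes Γ p (⨅ z : W e κ, imp (memW z α) (memW z β)) →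
      Realizes Γ (.app (.lam (.lam (.app (.var 1) (.app r (.var 0))))) p) (subW α β) :=
    fun {_ _ α _} h => .app (.lam <| .all fun t => .lam <|
      .app ((Realizes.var 1 rfl).mono (iInf_le _ t.1)) (.app (hr _ α t) (.var 0 rfl))) h
  have key : ∃ r : Term A, ∀ x y : W e κ, Realizes [] r
      (imp (conj (⨅ z : W e κ, imp (memW z x) (memW z y))
        (⨅ z : W e κ, imp (memW z y) (memW z x))) (eqW x y)) :=
    ⟨_, fun x y => .lam <| .letPair (.var 0 rfl) <|
      realizes_eqW (sub (.var 1 rfl)) (sub (.var 0 rfl))⟩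
  obtain ⟨s, hs⟩ := key
  exact interp_mem_sep ⟨s, .all fun x => .all fun y => hs x y⟩

theorem interp_axPair_mem_sep (hκ : κ.IsInaccessible) :
    interp SetFormula.axPair (Fin.elim0 : Fin 0 → W e κ) ∈ (sep : Set A) := by
  obtain ⟨r, hr⟩ := exists_realizes_memW_of_val_eq_top (A := A) e κ
  refine interp_mem_sep ⟨.wit (.pair r r), .all fun x => .all fun y => ?_⟩
  obtain ⟨γ, hγ, hx⟩ := x.exists_level hκ
  obtain ⟨δ, hδ, hy⟩ := y.exists_level hκ
  obtain ⟨u, -, hu⟩ := exists_level_set (e := e) hκ (max_lt hγ hδ)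
  exact .wit u <| .pair (hr _ u x (hu x (hierarchy_mono (le_max_left γ δ) hx)))
    (hr _ u y (hu y (hierarchy_mono (le_max_right γ δ) hy)))

/-- The union of `x` is bounded by any level `W_γ` that contains `x`, because levels are closed
under passing to elements of domains. -/
theorem interp_axUnion_mem_sep (hκ : κ.IsInaccessible) :
    interp SetFormula.axUnion (Fin.elim0 : Fin 0 → W e κ) ∈ (sep : Set A) := by
  obtain ⟨r, hr⟩ := exists_realizes_memW_of_val_eq_top (A := A) e κ
  obtain ⟨left, hleft⟩ := exists_realizes_memW_congr_left (A := A) e κ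
  obtain ⟨right, hright⟩ := exists_realizes_memW_congr_right (A := A) e κ
  obtain ⟨symm, hsymm⟩ := exists_realizes_eqW_symm (A := A) e κ
  have key : ∃ s : Term A, ∀ x u : W e κ,
      (∀ t : dom x, ∀ z : dom t.1, ∃ z' : dom u, z'.1 = z.1 ∧ val u z' = ⊤) →
      Realizes [] s (⨅ y : W e κ, imp (memW y x) (⨅ z : W e κ, imp (memW z y) (memW z u))) :=
    ⟨_, fun x u h => .all fun y => .lam <| .all fun z => .lam <|
      realizes_of_memW (.var 1 rfl) fun t =>
      realizes_of_memW (.app (.app (hright _ z y t.1) (.app (hsymm _ t.1 y) (.var 0 rfl)))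
        (.var 2 rfl)) fun s =>
      .app (.app (hleft _ s.1 z u) (.var 0 rfl)) (hr _ u s.1 (h t s))⟩
  obtain ⟨s, hs⟩ := key
  refine interp_mem_sep ⟨.wit s, .all fun x => ?_⟩
  obtain ⟨γ, hγ, hx⟩ := x.exists_level hκ
  obtain ⟨u, -, hu⟩ := exists_level_set (e := e) hκ hγ
  exact .wit u <| hs x u fun t z =>
    hu z.1 (mem_hierarchy_of_mem_dom (mem_hierarchy_of_mem_dom hx t.2) z.2)

/-- A subset `y` of `x` equals the function `t ↦ (t ∈_W y)` with the same domain as `x`, and these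
functions all lie in the same level of the hierarchy. -/
theorem interp_axPow_mem_sep (hκ : κ.IsInaccessible) :
    interp SetFormula.axPow (Fin.elim0 : Fin 0 → W e κ) ∈ (sep : Set A) := by
  obtain ⟨r, hr⟩ := exists_realizes_memW_of_val_eq_top (A := A) e κ
  obtain ⟨self, hself⟩ := exists_realizes_memW_of_val (A := A) e κ
  obtain ⟨left, hleft⟩ := exists_realizes_memW_congr_left (A := A) e κ
  obtain ⟨symm, hsymm⟩ := exists_realizes_eqW_symm (A := A) e κ
  have key : ∃ s : Term A, ∀ x y y' u : W e κ, dom y' = dom x →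
      (∀ t : dom y', val y' t = memW t.1 y) → (∃ t : dom u, t.1 = y' ∧ val u t = ⊤) →
      Realizes [] s (imp (⨅ z : W e κ, imp (memW z y) (memW z x)) (memW y u)) :=
    ⟨_, fun x y y' u hdom hval hu => .lam <| .app (.app (hleft _ y' y u) <| realizes_eqW
      (.all fun t => .lam <| (Realizes.var 0 rfl).mono (hval t).le)
      (.all fun s => .lam <| realizes_of_memW (α := s.1) (β := x)
        (.app ((Realizes.var 1 rfl).mono (iInf_le _ s.1)) (.app (hself _ y s) (.var 0 rfl))) fun t =>
        realizes_memW ⟨t.1, hdom.ge t.2⟩ ((Realizes.app (.app (hleft _ s.1 t.1 y)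
          (.app (hsymm _ t.1 s.1) (.var 0 rfl))) (.app (hself _ y s) (.var 2 rfl))).mono
            (hval ⟨t.1, hdom.ge t.2⟩).ge) (.var 0 rfl)))
      (hr _ u y' hu)⟩
  obtain ⟨s, hs⟩ := key
  refine interp_mem_sep ⟨.wit s, .all fun x => ?_⟩
  obtain ⟨γ, hγ, hx⟩ := x.exists_level hκ
  obtain ⟨u, -, hu⟩ := exists_level_set (e := e) hκ ((isSuccLimit_ord hκ).add_one_lt hγ)
  refine .wit u <| .all fun y => ?_
  obtain ⟨y', hy', hdom, hval⟩ := exists_W hκ hγ (dom x)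
    (fun t ht => mem_hierarchy_of_mem_dom hx ht) fun t => memW t y
  exact hs x y y' u hdom hval (hu y' hy')

/-- The witness is `W_ω`.  The successor of `t` is the function `s ↦ (s ∈_W t) + (s =_W t)` on
`∂₀(t) ∪ {t}`; these values let a single realizer decide whether a member of the successor
is a member of `t` or equal to `t`. -/
theorem interp_axInf_mem_sep (hκ : κ.IsInaccessible) :
    interp SetFormula.axInf (Fin.elim0 : Fin 0 → W e κ) ∈ (sep : Set A) := by
  obtain ⟨r, hr⟩ := exists_realizes_memW_of_val_eq_top (A := A) e κ
  obtain ⟨refl, hrefl⟩ := exists_realizes_eqW_refl (A := A) e κ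
  obtain ⟨self, hself⟩ := exists_realizes_memW_of_val (A := A) e κ
  obtain ⟨left, hleft⟩ := exists_realizes_memW_congr_left (A := A) e κ
  obtain ⟨right, hright⟩ := exists_realizes_memW_congr_right (A := A) e κ
  obtain ⟨symm, hsymm⟩ := exists_realizes_eqW_symm (A := A) e κ
  obtain ⟨trans, htrans⟩ := exists_realizes_eqW_trans (A := A) e κ
  -- the two halves of the axiom, for a set `u` that contains `∅` and is closed under successors
  have zero : ∃ s : Term A, ∀ x u : W e κ, dom x = ∅ → (∃ t : dom u, t.1 = x ∧ val u t = ⊤) →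
      Realizes [] s (exi fun x : W e κ => conj (memW x u) (⨅ y : W e κ, imp (memW y x) ⊥)) :=
    ⟨.wit (.pair r (.lam (.letBex (.var 0) (.var 0)))), fun x u hx hu => .wit x <|
      .pair (hr _ u x hu) <| .all fun y => .lam <| realizes_of_memW (.var 0 rfl) fun t =>
        absurd t.2 (by simp [hx])⟩
  have succ : ∃ s : Term A, ∀ (u : W e κ) (f : dom u → W e κ),
      (∀ t, dom (f t) = insert t.1 (dom t.1)) →
      (∀ t, ∀ s : dom (f t), val (f t) s = disj (memW s.1 t.1) (eqW s.1 t.1)) →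
      (∀ t, ∃ t' : dom u, t'.1 = f t ∧ val u t' = ⊤) →
      Realizes [] s (⨅ x : W e κ, imp (memW x u) (exi fun y : W e κ => conj (memW y u)
        (conj (⨅ z : W e κ, imp (memW z x) (memW z y)) (conj (memW x y)
          (⨅ z : W e κ, imp (memW z y) (disj (memW z x) (eqW z x))))))) :=
    ⟨_, fun u f hdom hval hu => .all fun x => .lam <| realizes_of_memW (.var 0 rfl) fun t =>
      .wit (f t) <| .pair (hr _ u _ (hu t)) <| .pair
        (.all fun z => .lam <| realizes_of_memW
          (.app (.app (hright _ z x t.1) (.app (hsymm _ t.1 x) (.var 1 rfl))) (.var 0 rfl))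
          fun s => realizes_memW ⟨s.1, (hdom t).ge (.inr s.2)⟩
            ((Realizes.inl (.app (hself _ t.1 s) (.var 1 rfl))).mono
              (hval t ⟨s.1, (hdom t).ge (.inr s.2)⟩).ge) (.var 0 rfl)) <| .pair
        (realizes_memW ⟨t.1, (hdom t).ge (.inl rfl)⟩
          ((Realizes.inr (a := memW t.1 t.1) (hrefl _ t.1)).mono
            (hval t ⟨t.1, (hdom t).ge (.inl rfl)⟩).ge) (.var 0 rfl)) <|
        .all fun z => .lam <| realizes_of_memW (.var 0 rfl) fun s =>
          .cases ((Realizes.var 1 rfl).mono (hval t s).le)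
            (.inl <| .app (.app (hright _ z t.1 x) (.var 4 rfl)) <|
              .app (.app (hleft _ s.1 z t.1) (.var 1 rfl)) (.var 0 rfl))
            (.inr <| .app (.app (htrans _ z s.1 x) (.app (hsymm _ s.1 z) (.var 1 rfl))) <|
              .app (.app (htrans _ s.1 t.1 x) (.var 0 rfl)) (.var 4 rfl))⟩
  obtain ⟨z, hz⟩ := zero
  obtain ⟨s, hs⟩ := succ
  have hω : Ordinal.omega0 < κ.ord := by
    rw [← Cardinal.ord_aleph0]
    exact Cardinal.ord_lt_ord.2 hκ.aleph0_lt
  obtain ⟨u, hu', hu⟩ := exists_level_set (e := e) hκ hω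
  refine interp_mem_sep ⟨.wit (.pair z s), .wit u <| .pair ?_ ?_⟩
  · obtain ⟨x, hx, hdom, -⟩ := exists_W (e := e) hκ (hκ.isRegular.ord_pos) ∅
      (fun _ h => absurd h (Set.notMem_empty _)) fun _ => ⊤
    exact hz x u hdom (hu x ((mem_hierarchy_limit Ordinal.isSuccLimit_omega0).2
      ⟨_, Ordinal.isSuccLimit_omega0.add_one_lt Ordinal.omega0_pos, hx⟩))
  · have h : ∀ t : dom u, ∃ y : W e κ, dom y = insert t.1 (dom t.1) ∧
        (∀ s : dom y, val y s = disj (memW s.1 t.1) (eqW s.1 t.1)) ∧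
        ∃ t' : dom u, t'.1 = y ∧ val u t' = ⊤ := by
      intro t
      obtain ⟨γ, hγ, ht⟩ := (mem_hierarchy_limit Ordinal.isSuccLimit_omega0).1 (hu' t)
      obtain ⟨y, hy, hdom, hval⟩ := exists_W (e := e) hκ (hγ.trans hω) (insert t.1 (dom t.1))
        (by
          rintro s (rfl | hs)
          · exact ht
          · exact mem_hierarchy_of_mem_dom ht hs) fun s => disj (memW s t.1) (eqW s t.1)
      exact ⟨y, hdom, hval, hu y ((mem_hierarchy_limit Ordinal.isSuccLimit_omega0).2
        ⟨_, Ordinal.isSuccLimit_omega0.add_one_lt hγ, hy⟩)⟩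
    choose f hdom hval hf using h
    exact hs u f hdom hval hf

end Axioms

end ImpModel

namespace ImpModel

open ImplicativeAlgebra

/-! ### The axiom schemes -/

section Schemes

variable {A : Type u} {e : A ↪ ZFSet.{u}} {κ : Cardinal.{u}} [ImplicativeAlgebra A]

variable (e κ) in
theorem exists_realizes_interp_congr_zero {n : ℕ} (φ : SetFormula (n + 1)) :
    ∃ r : Term A, ∀ (Γ : List A) (v : Fin n → W e κ) (α β : W e κ), Realizes Γ r
      (imp (eqW α β) (imp (interp φ (Fin.cons α v : Fin (n + 1) → W e κ))
        (interp φ (Fin.cons β v : Fin (n + 1) → W e κ)))) := by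
  obtain ⟨r, hr⟩ := exists_realizes_interp_congr (A := A) e κ φ 0
  refine ⟨r, fun Γ v α β => hr Γ (Fin.cons α v) (Fin.cons β v) fun j => ?_⟩
  exact Fin.cases (fun h => absurd rfl h) (fun j _ => rfl) j

variable (e κ) in
theorem exists_realizes_interp_congr_one {n : ℕ} (φ : SetFormula (n + 2)) :
    ∃ r : Term A, ∀ (Γ : List A) (v : Fin n → W e κ) (γ α β : W e κ), Realizes Γ r
      (imp (eqW α β)
        (imp (interp φ (Fin.cons γ (Fin.cons α v : Fin (n + 1) → W e κ) : Fin (n + 2) → W e κ))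
          (interp φ (Fin.cons γ (Fin.cons β v : Fin (n + 1) → W e κ) : Fin (n + 2) → W e κ)))) := by
  obtain ⟨r, hr⟩ := exists_realizes_interp_congr (A := A) e κ φ 1
  refine ⟨r, fun Γ v γ α β => hr Γ (Fin.cons γ (Fin.cons α v : Fin (n + 1) → W e κ))
    (Fin.cons γ (Fin.cons β v : Fin (n + 1) → W e κ)) fun j => ?_⟩
  refine Fin.cases (fun _ => rfl) (fun j => ?_) j
  exact Fin.cases (fun h => absurd rfl h) (fun j _ => rfl) j

/-- The witness is the function `t ↦ x(t) × φ(t)` with the same domain as the given set `x`. -/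
theorem interp_axSep_mem_sep (hκ : κ.IsInaccessible) {n : ℕ} (φ : SetFormula (n + 2)) :
    interp (SetFormula.axSep φ) (Fin.elim0 : Fin 0 → W e κ) ∈ (sep : Set A) := by
  obtain ⟨c, hc⟩ := exists_realizes_interp_congr_zero (A := A) e κ φ
  obtain ⟨symm, hsymm⟩ := exists_realizes_eqW_symm (A := A) e κ
  have key : ∃ s : Term A, ∀ (x y : W e κ) (Φ : W e κ → A),
      (∀ Γ α β, Realizes Γ c (imp (eqW α β) (imp (Φ α) (Φ β)))) → dom y = dom x →
      (∀ (t : dom x) (t' : dom y), t'.1 = t.1 → val y t' = conj (val x t) (Φ t.1)) →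
      Realizes [] s (conj (⨅ z : W e κ, imp (memW z y) (conj (memW z x) (Φ z)))
        (⨅ z : W e κ, imp (memW z x) (imp (Φ z) (memW z y)))) :=
    ⟨_, fun x y Φ hΦ hdom hval => .pair
      (.all fun z => .lam <| realizes_of_memW (.var 0 rfl) fun t =>
        .letPair ((Realizes.var 1 rfl).mono (hval ⟨t.1, hdom.le t.2⟩ t rfl).le) <| .pair
          (realizes_memW ⟨t.1, hdom.le t.2⟩ (.var 1 rfl) (.var 2 rfl))
          (.app (.app (hΦ _ t.1 z) (.var 2 rfl)) (.var 0 rfl)))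
      (.all fun z => .lam <| .lam <| realizes_of_memW (.var 1 rfl) fun t =>
        realizes_memW ⟨t.1, hdom.ge t.2⟩
          ((Realizes.pair (.var 1 rfl) (.app (.app (hΦ _ z t.1)
            (.app (hsymm _ t.1 z) (.var 0 rfl))) (.var 2 rfl))).mono
            (hval t ⟨t.1, hdom.ge t.2⟩ rfl).ge) (.var 0 rfl))⟩
  obtain ⟨s, hs⟩ := key
  refine interp_closure_mem_sep ⟨.wit s, fun w => .all fun x => ?_⟩
  obtain ⟨γ, hγ, hx⟩ := x.exists_level hκ
  let Φ : W e κ → A := fun z => interp φ (Fin.cons z (Fin.cons x w : Fin (n + 1) → W e κ))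
  -- the meet over proofs of `t ∈ dom x` extends `t ↦ x(t) × φ(t)` by the value `⊤` outside `dom x`
  obtain ⟨y, -, hdom, hval⟩ := exists_W (A := A) hκ hγ (dom x)
    (fun t ht => mem_hierarchy_of_mem_dom hx ht) fun t =>
      ⨅ (h : t ∈ dom x), conj (val x ⟨t, h⟩) (Φ t)
  refine .wit y ?_
  have h := hs x y Φ (fun Γ α β => hc Γ _ α β) hdom fun t t' ht => by
    rw [hval, ht, iInf_pos t.2]
  have hφ : ∀ z : W e κ, interp (φ.subst (Fin.cons 0 fun i => i.succ.succ :
      Fin (n + 2) → Fin (n + 3))) (Fin.cons z (Fin.cons y (Fin.cons x w : Fin (n + 1) → W e κ) :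
        Fin (n + 2) → W e κ) : Fin (n + 3) → W e κ) = Φ z := by
    intro z
    rw [interp_subst]
    refine congrArg (interp φ) (funext fun i => ?_)
    refine Fin.cases ?_ (fun i => ?_) i <;> simp
  simp only [SetFormula.ballIn, interp, hφ]
  exact h

/-- The witness is a level `W_γ` that contains, for all `t` in the domain of the given set, enough
`z` to attain all the values of `φ(t, z)`, so that it bounds the existential quantifier without
changing its value. -/
theorem interp_axCol_mem_sep (hκ : κ.IsInaccessible) (hA : Cardinal.mk A < κ) {n : ℕ}
    (φ : SetFormula (n + 3)) :
    interp (SetFormula.axCol φ) (Fin.elim0 : Fin 0 → W e κ) ∈ (sep : Set A) := by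
  obtain ⟨c, hc⟩ := exists_realizes_interp_congr_one (A := A) e κ φ
  obtain ⟨r, hr⟩ := exists_realizes_memW_of_val_eq_top (A := A) e κ
  obtain ⟨self, hself⟩ := exists_realizes_memW_of_val (A := A) e κ
  have key : ∃ s : Term A, ∀ (y u : W e κ) (Φ : W e κ → W e κ → A) (g : dom y → W e κ → W e κ),
      (∀ Γ z α β, Realizes Γ c (imp (eqW α β) (imp (Φ α z) (Φ β z)))) →
      (∀ t z, ∃ t' : dom u, t'.1 = g t z ∧ val u t' = ⊤) →
      (∀ t z, Φ t.1 (g t z) = Φ t.1 z) →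
      Realizes [] s (imp (⨅ x : W e κ, imp (memW x y) (exi fun z : W e κ => Φ x z))
        (exi fun u : W e κ => ⨅ x : W e κ, imp (memW x y)
          (exi fun z : W e κ => conj (memW z u) (Φ x z)))) :=
    ⟨_, fun y u Φ g hΦ hg hgΦ => .lam <| .wit (f := fun u : W e κ => ⨅ x : W e κ,
        imp (memW x y) (exi fun z : W e κ => conj (memW z u) (Φ x z))) u <|
      .all fun x => .lam <| realizes_of_memW (.var 0 rfl) fun t =>
      .letWit (.app ((Realizes.var 3 rfl).mono (iInf_le _ t.1))
        (.app (hself _ y t) (.var 1 rfl))) fun z =>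
      .wit (g t z) <| .pair (hr _ u (g t z) (hg t z)) <|
        .app (.app (hΦ _ (g t z) t.1 x) (.var 1 rfl)) ((Realizes.var 0 rfl).mono (hgΦ t z).ge)⟩
  obtain ⟨s, hs⟩ := key
  refine interp_closure_mem_sep ⟨s, fun w => .all fun y => ?_⟩
  let Φ : W e κ → W e κ → A := fun x z =>
    interp φ (Fin.cons z (Fin.cons x (Fin.cons y w : Fin (n + 1) → W e κ) : Fin (n + 2) → W e κ))
  obtain ⟨γ, hγ, h⟩ := exists_level_witnesses hκ hA y fun t => Φ t.1
  obtain ⟨u, -, hu⟩ := exists_level_set (e := e) hκ hγ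
  choose g hg hgΦ using h
  have h := hs y u Φ g (fun Γ z α β => hc Γ _ z α β) (fun t z => hu _ (hg t z)) hgΦ
  have hφ : ∀ u x z : W e κ, interp (φ.subst (Fin.cons 0 (Fin.cons 1 fun i => i.succ.succ.succ) :
      Fin (n + 3) → Fin (n + 4))) (Fin.cons z (Fin.cons x (Fin.cons u (Fin.cons y w :
        Fin (n + 1) → W e κ) : Fin (n + 2) → W e κ) : Fin (n + 3) → W e κ) :
          Fin (n + 4) → W e κ) = Φ x z := by
    intro u x z
    rw [interp_subst]
    refine congrArg (interp φ) (funext fun i => ?_)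
    refine Fin.cases ?_ (fun i => Fin.cases ?_ (fun i => ?_) i) i <;> rfl
  simp only [SetFormula.ballIn, SetFormula.bexIn, interp, hφ]
  exact h

/-- The realizer is the fixed point combinator: a hypothesis on the elements of the domain of `x`
transfers to all members of `x`, as formulas respect equality. -/
theorem interp_axInd_mem_sep {n : ℕ} (φ : SetFormula (n + 1)) :
    interp (SetFormula.axInd φ) (Fin.elim0 : Fin 0 → W e κ) ∈ (sep : Set A) := by
  obtain ⟨c, hc⟩ := exists_realizes_interp_congr_zero (A := A) e κ φ
  obtain ⟨y, hy⟩ := exists_realizes_induction (A := A) (wellFounded_dom (e := e) (κ := κ))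
  have key : ∃ s : Term A, ∀ Φ : W e κ → A,
      (∀ Γ α β, Realizes Γ c (imp (eqW α β) (imp (Φ α) (Φ β)))) →
      Realizes [] s (imp (⨅ x : W e κ, imp (⨅ y : W e κ, imp (memW y x) (Φ y)) (Φ x))
        (⨅ x : W e κ, Φ x)) :=
    ⟨_, fun Φ hΦ => .lam <| .app (hy _ Φ) <| .all fun x => .lam <|
      .app ((Realizes.var 1 rfl).mono (iInf_le _ x)) <| .all fun y => .lam <|
      realizes_of_memW (.var 0 rfl) fun t => .app (.app (hΦ _ t.1 y) (.var 0 rfl))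
        ((Realizes.var 3 rfl).mono (iInf_le _ t))⟩
  obtain ⟨s, hs⟩ := key
  refine interp_closure_mem_sep ⟨s, fun w => ?_⟩
  have h := hs (fun x => interp φ (Fin.cons x w)) fun Γ α β => hc Γ w α β
  have hφ : ∀ x y : W e κ, interp (φ.subst (Fin.cons 0 fun i => i.succ.succ :
      Fin (n + 1) → Fin (n + 2))) (Fin.cons y (Fin.cons x w : Fin (n + 1) → W e κ) :
        Fin (n + 2) → W e κ) = interp φ (Fin.cons y w : Fin (n + 1) → W e κ) := by
    intro x y
    rw [interp_subst]
    refine congrArg (interp φ) (funext fun i => ?_)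
    refine Fin.cases ?_ (fun i => ?_) i <;> rfl
  simp only [SetFormula.ballIn, interp, hφ]
  exact h

theorem interp_mem_sep_of_zfAxiom (hκ : κ.IsInaccessible) (hA : Cardinal.mk A < κ)
    {φ : SetFormula 0} (hφ : SetFormula.ZFAxiom φ) :
    interp φ (Fin.elim0 : Fin 0 → W e κ) ∈ (sep : Set A) := by
  cases hφ with
  | ext => exact interp_axExt_mem_sep
  | pair => exact interp_axPair_mem_sep hκ
  | union => exact interp_axUnion_mem_sep hκ
  | pow => exact interp_axPow_mem_sep hκ
  | inf => exact interp_axInf_mem_sep hκ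
  | sep φ => exact interp_axSep_mem_sep hκ φ
  | col φ => exact interp_axCol_mem_sep hκ hA φ
  | ind φ => exact interp_axInd_mem_sep φ

end Schemes

/-! ### Soundness -/

section Soundness

variable {A : Type u} {e : A ↪ ZFSet.{u}} {κ : Cardinal.{u}} [ImplicativeAlgebra A]

theorem map_interp_map_weaken {n : ℕ} (Γ : List (SetFormula n)) (v : Fin n → W e κ) (β : W e κ) :
    (Γ.map SetFormula.weaken).map
      (fun ψ => interp ψ (Fin.cons β v : Fin (n + 1) → W e κ)) = Γ.map (interp · v) := by
  rw [List.map_map]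
  exact List.map_congr_left fun ψ _ => interp_weaken ψ v β

/-- Soundness: from a derivation one reads off a λ-term that realizes the conclusion under the
hypotheses, the same term for all valuations. -/
theorem exists_realizes_of_derives {c : Prop} {T : Set (SetFormula 0)}
    (hT : ∀ φ ∈ T, interp φ (Fin.elim0 : Fin 0 → W e κ) ∈ (sep : Set A))
    (hc : c → IsClassical A) {n : ℕ} {Γ : List (SetFormula n)} {φ : SetFormula n}
    (h : SetFormula.Derives c T Γ φ) :
    ∃ t : Term A, ∀ v : Fin n → W e κ, Realizes (Γ.map (interp · v)) t (interp φ v) := by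
  induction h with
  | @ax n Γ φ h =>
    refine ⟨.const _ (hT φ h), fun v => ?_⟩
    rw [interp_subst, Subsingleton.elim (v ∘ Fin.elim0) Fin.elim0]
    exact .const _
  | hyp h =>
    obtain ⟨k, hk⟩ := List.getElem?_of_mem h
    exact ⟨.var k, fun v => .var k (by simp [hk])⟩
  | botE _ ih =>
    obtain ⟨t, ht⟩ := ih
    exact ⟨t, fun v => .botE (ht v)⟩
  | andI _ _ ih ih' =>
    obtain ⟨t, ht⟩ := ih
    obtain ⟨s, hs⟩ := ih'
    exact ⟨_, fun v => .pair (ht v) (hs v)⟩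
  | andE₁ _ ih =>
    obtain ⟨t, ht⟩ := ih
    exact ⟨_, fun v => .fst (ht v)⟩
  | andE₂ _ ih =>
    obtain ⟨t, ht⟩ := ih
    exact ⟨_, fun v => .snd (ht v)⟩
  | orI₁ _ ih =>
    obtain ⟨t, ht⟩ := ih
    exact ⟨_, fun v => .inl (ht v)⟩
  | orI₂ _ ih =>
    obtain ⟨t, ht⟩ := ih
    exact ⟨_, fun v => .inr (ht v)⟩
  | orE _ _ _ ih ih₁ ih₂ =>
    obtain ⟨t, ht⟩ := ih
    obtain ⟨s, hs⟩ := ih₁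
    obtain ⟨r, hr⟩ := ih₂
    exact ⟨_, fun v => .cases (ht v) (hs v) (hr v)⟩
  | impI _ ih =>
    obtain ⟨t, ht⟩ := ih
    exact ⟨_, fun v => .lam (ht v)⟩
  | impE _ _ ih ih' =>
    obtain ⟨t, ht⟩ := ih
    obtain ⟨s, hs⟩ := ih'
    exact ⟨_, fun v => .app (ht v) (hs v)⟩
  | allI _ ih =>
    obtain ⟨t, ht⟩ := ih
    exact ⟨t, fun v => .all fun β => map_interp_map_weaken _ v β ▸ ht (Fin.cons β v)⟩
  | allE i _ ih =>
    obtain ⟨t, ht⟩ := ih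
    refine ⟨t, fun v => ?_⟩
    rw [interp_inst]
    exact (ht v).mono (iInf_le _ (v i))
  | exI i _ ih =>
    obtain ⟨t, ht⟩ := ih
    exact ⟨_, fun v => .wit (v i) (interp_inst _ i v ▸ ht v)⟩
  | exE _ _ ih ih' =>
    obtain ⟨t, ht⟩ := ih
    obtain ⟨s, hs⟩ := ih'
    refine ⟨_, fun v => .letWit (ht v) (s := s) fun β => ?_⟩
    have h := hs (Fin.cons β v)
    rwa [interp_weaken, List.map_cons, map_interp_map_weaken] at h
  | eqRefl i =>
    obtain ⟨r, hr⟩ := exists_realizes_eqW_refl (A := A) e κ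
    exact ⟨r, fun v => hr _ (v i)⟩
  | @eqSubst n Γ φ i j _ _ ih ih' =>
    obtain ⟨r, hr⟩ := exists_realizes_interp_congr_zero (A := A) e κ φ
    obtain ⟨t, ht⟩ := ih
    obtain ⟨s, hs⟩ := ih'
    refine ⟨.app (.app r t) s, fun v => ?_⟩
    rw [interp_inst]
    exact .app (.app (hr _ v (v i) (v j)) (ht v)) (interp_inst φ i v ▸ hs v)
  | @raa n Γ φ h _ ih =>
    obtain ⟨t, ht⟩ := ih
    -- Peirce's law for `φ` and `⊥`
    exact ⟨_, fun v => .app ((Realizes.const (hc h)).mono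
      ((iInf_le _ (interp φ v)).trans (iInf_le _ ⊥))) (.lam (ht v).botE)⟩

theorem models_of_derives {c : Prop} {T : Set (SetFormula 0)}
    (hT : ∀ φ ∈ T, interp φ (Fin.elim0 : Fin 0 → W e κ) ∈ (sep : Set A))
    (hc : c → IsClassical A) {n : ℕ} {φ : SetFormula n} (h : SetFormula.Derives c T [] φ) :
    Models e κ φ :=
  let ⟨t, ht⟩ := exists_realizes_of_derives (e := e) (κ := κ) hT hc h
  sep_upward (le_iInf ht) t.eval_nil_mem_sep

end Soundness

end ImpModel

theorem mainTheorem1 {A : Type u} [ImplicativeAlgebra A] {κ : Cardinal.{u}}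
    (hκ : κ.IsInaccessible) (hA : Cardinal.mk A < κ) (e : A ↪ ZFSet.{u}) :
    (∀ φ : SetFormula 0, SetFormula.ZFAxiom φ →
      ImpModel.interp φ (Fin.elim0 : Fin 0 → ImpModel.W e κ) ∈
        (ImplicativeAlgebra.sep : Set A)) ∧
    (∀ (n : ℕ) (φ : SetFormula n), SetFormula.IZFProves φ → ImpModel.Models e κ φ) ∧
    (ImplicativeAlgebra.IsClassical A →
      ∀ (n : ℕ) (φ : SetFormula n), SetFormula.ZFProves φ → ImpModel.Models e κ φ) := by
  have h : ∀ φ : SetFormula 0, SetFormula.ZFAxiom φ →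
      ImpModel.interp φ (Fin.elim0 : Fin 0 → ImpModel.W e κ) ∈
        (ImplicativeAlgebra.sep : Set A) := fun _ =>
    ImpModel.interp_mem_sep_of_zfAxiom hκ hA
  exact ⟨h, fun _ _ => ImpModel.models_of_derives h False.elim,
    fun hc _ _ => ImpModel.models_of_derives h fun _ => hc⟩
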